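/- Let $n\ge 1$, let $\mathcal P_n$ be the set of real symmetric positive-definite $n\times n$ matrices, and for $0\neq\beta<1/n$ let $\mathcal M_n^\beta$ be $\mathcal P_n$ with the Riemannian metric $$g_X^\beta(H,K)=\det(X)^\beta\bigl(\operatorname{tr}(X^{-1}HX^{-1}K)-\beta\operatorname{tr}(X^{-1}H)\operatorname{tr}(X^{-1}K)\bigr)$$ on symmetric $H,K$. The length of a $C^2$ curve $P:[0,1]\to\mathcal P_n$ is $\int_0^1\sqrt{g^\beta_{P(t)}(P'(t),P'(t))}\,dt$. A geodesic joining $A$ and $B$ is a $C^2$ curve $P:[0,1]\to\mathcal P_n$ with $P(0)=A$, $P(1)=B$ that has minimal length among all such curves and has constant speed $\sqrt{g^\beta_{P}(P',P')}$. That $G$ is the unique geodesic joining $A$ and $B$ means that $G$ is such a geodesic, that every such geodesic equals $G$, and that every $C^2$ curve of minimal length from $A$ to $B$, without condition on its speed, is of the form $G\circ\varphi$ with $\varphi:[0,1]\to[0,1]$ continuous, nondecreasing, $\varphi(0)=0$, $\varphi(1)=1$. For a matrix $C=M^{-1}\operatorname{diag}(d_1,\dots,d_n)M$ with all $d_i>0$,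 put $C^q=M^{-1}\operatorname{diag}(d_1^q,\dots,d_n^q)M$. Let $A,B\in\mathcal P_n$. Put $d=\bigl(\sum_{i=1}^n\ln^2\widetilde\mu_i\bigr)^{1/2}$, where $\widetilde\mu_1,\dots,\widetilde\mu_n$ are the eigenvalues of $\widetilde A^{-1}\widetilde B$ with $\widetilde A=\det(A)^{-1/n}A$, $\widetilde B=\det(B)^{-1/n}B$, and for $0\ne\beta<1/n$ put $$\gamma=\gamma_\beta(A,B)=\frac{|\beta|\,d}{2\sqrt{1/n-\beta}},\qquad \sigma=\det(A^{-1}B)^{\beta/2}.$$ (1) Suppose that $A$ and $B$ are linearly independent, and put $$\beta_1=-\pi\,\frac{\sqrt{\pi^2n^2+4nd^2}+\pi n}{2nd^2},\qquad \beta_2=\pi\,\frac{\sqrt{\pi^2n^2+4nd^2}-\pi n}{2nd^2}.$$ Then $\beta_1<0<\beta_2<1/n$, and for $0\ne\beta<1/n$ one has $\beta\in(\beta_1,0)\cup(0,\beta_2)$ if and only if $0<\gamma_\beta(A,B)<\pi/2$. For every such $\beta$ there is a unique geodesic of $\mathcal M_n^\beta$ joining $A$ and $B$, namely $$G_\beta(A,B,t)=\eta(t)\,A(A^{-1}B)^{\alpha(t)},\qquad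 t\in[0,1],$$ where $$\alpha(t)=\frac1\gamma\arctan\Bigl(\frac{t\sigma\sin\gamma}{1-t+t\sigma\cos\gamma}\Bigr),\qquad \eta(t)=\Bigl(\frac{(1-t)^2+2t(1-t)\sigma\cos\gamma+t^2\sigma^2}{\sigma^{2\alpha(t)}}\Bigr)^{\frac1{n\beta}}.$$ (2) Suppose that $A$ and $B$ are linearly dependent. Then for every $\beta\in(-\infty,0)\cup(0,1/n)$ there is a unique geodesic of $\mathcal M_n^\beta$ joining $A$ and $B$, namely $$G_\beta(A,B,t)=\bigl((1-t)A^{n\beta/2}+tB^{n\beta/2}\bigr)^{2/(n\beta)},\qquad t\in[0,1].$$ -/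

import Mathlib

open Set Matrix

noncomputable section

namespace PowerCone

variable {n : ℕ}

/-! ### Real powers of diagonalizable matrices with positive eigenvalues -/

/-- `C = M⁻¹ diag(d) M` with `M` invertible and all `d i > 0`. -/
def IsPosDiagonalization (C M : Matrix (Fin n) (Fin n) ℝ) (d : Fin n → ℝ) : Prop :=
  IsUnit M ∧ (∀ i, 0 < d i) ∧ C = M⁻¹ * diagonal d * M

open Classical in
/-- The primary matrix function `C ^ q = M⁻¹ diag(dᵢ ^ q) M` of a matrix `C = M⁻¹ diag(d) M` that is
diagonalizable with positive eigenvalues (and the junk value `0` for all other matrices).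
The value does not depend on the diagonalization, see `matPow_eq`. -/
def matPow (C : Matrix (Fin n) (Fin n) ℝ) (q : ℝ) : Matrix (Fin n) (Fin n) ℝ :=
  if h : ∃ p : Matrix (Fin n) (Fin n) ℝ × (Fin n → ℝ), IsPosDiagonalization C p.1 p.2 then
    h.choose.1⁻¹ * diagonal (fun i => h.choose.2 i ^ q) * h.choose.1
  else 0

theorem primary_unique {C M N : Matrix (Fin n) (Fin n) ℝ} {d e : Fin n → ℝ}
    (hM : IsPosDiagonalization C M d) (hN : IsPosDiagonalization C N e) (q : ℝ) :
    M⁻¹ * diagonal (fun i => d i ^ q) * M = N⁻¹ * diagonal (fun i => e i ^ q) * N := by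
  obtain ⟨hMu, -, hMe⟩ := hM
  obtain ⟨hNu, -, hNe⟩ := hN
  have hMd := (Matrix.isUnit_iff_isUnit_det M).1 hMu
  have hNd := (Matrix.isUnit_iff_isUnit_det N).1 hNu
  have h1 : diagonal d * (M * N⁻¹) = (M * N⁻¹) * diagonal e := by
    have h : M * (M⁻¹ * diagonal d * M) * N⁻¹ = M * (N⁻¹ * diagonal e * N) * N⁻¹ := by
      rw [← hMe, ← hNe]
    simpa [Matrix.mul_assoc, Matrix.mul_nonsing_inv_cancel_left _ _ hMd,
      Matrix.mul_nonsing_inv _ hNd] using h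
  have h2 : diagonal (fun i => d i ^ q) * (M * N⁻¹)
      = (M * N⁻¹) * diagonal (fun i => e i ^ q) := by
    ext i j
    have h := congrFun (congrFun h1 i) j
    rw [Matrix.diagonal_mul, Matrix.mul_diagonal] at h ⊢
    by_cases h0 : (M * N⁻¹) i j = 0
    · simp [h0]
    · have hde : d i = e j := by
        apply mul_right_cancel₀ h0
        rw [h, mul_comm]
      rw [hde, mul_comm]
  have h3 : M⁻¹ * (diagonal (fun i => d i ^ q) * (M * N⁻¹)) * N
      = M⁻¹ * ((M * N⁻¹) * diagonal (fun i => e i ^ q)) * N := by rw [h2]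
  simpa [Matrix.mul_assoc, Matrix.nonsing_inv_mul_cancel_left _ _ hMd,
      Matrix.nonsing_inv_mul _ hNd] using h3

theorem matPow_eq {C M : Matrix (Fin n) (Fin n) ℝ} {d : Fin n → ℝ}
    (hM : IsPosDiagonalization C M d) (q : ℝ) :
    matPow C q = M⁻¹ * diagonal (fun i => d i ^ q) * M := by
  have h : ∃ p : Matrix (Fin n) (Fin n) ℝ × (Fin n → ℝ), IsPosDiagonalization C p.1 p.2 :=
    ⟨(M, d), hM⟩
  rw [matPow, dif_pos h]
  exact primary_unique h.choose_spec hM q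

/-! ### The Riemannian manifold `P_n` with the power metric, and its geodesics -/

/-- The Riemannian metric at `X` on symmetric matrices,
`(det X)^β (tr(X⁻¹ H X⁻¹ K) - β tr(X⁻¹ H) tr(X⁻¹ K))`. -/
def metric (β : ℝ) (X H K : Matrix (Fin n) (Fin n) ℝ) : ℝ :=
  X.det ^ β * ((X⁻¹ * H * X⁻¹ * K).trace - β * (X⁻¹ * H).trace * (X⁻¹ * K).trace)

/-- The derivative on `[0,1]` (one-sided at the endpoints) of a matrix-valued curve. -/
def velocity (P : ℝ → Matrix (Fin n) (Fin n) ℝ) (t : ℝ) : Matrix (Fin n) (Fin n) ℝ :=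
  Matrix.of fun i j => derivWithin (fun s => P s i j) (Icc 0 1) t

/-- The `C²` curves `[0,1] → P_n` from `A` to `B`; values outside `[0,1]` are irrelevant. -/
structure IsCurve (A B : Matrix (Fin n) (Fin n) ℝ) (P : ℝ → Matrix (Fin n) (Fin n) ℝ) :
    Prop where
  posDef : ∀ t ∈ Icc (0 : ℝ) 1, (P t).PosDef
  contDiffOn : ∀ i j, ContDiffOn ℝ 2 (fun t => P t i j) (Icc 0 1)
  source : P 0 = A
  target : P 1 = B

/-- The speed of a curve in the metric with parameter `β`. -/
def speed (β : ℝ) (P : ℝ → Matrix (Fin n) (Fin n) ℝ) (t : ℝ) : ℝ :=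
  √(metric β (P t) (velocity P t) (velocity P t))

/-- The length of a curve `[0,1] → P_n`. -/
def length (β : ℝ) (P : ℝ → Matrix (Fin n) (Fin n) ℝ) : ℝ :=
  ∫ t in (0 : ℝ)..1, speed β P t

/-- `P` has minimal length among the `C²` curves in `P_n` from `A` to `B`. -/
def IsLengthMinimizing (β : ℝ) (A B : Matrix (Fin n) (Fin n) ℝ)
    (P : ℝ → Matrix (Fin n) (Fin n) ℝ) : Prop :=
  IsCurve A B P ∧ ∀ Q : ℝ → Matrix (Fin n) (Fin n) ℝ, IsCurve A B Q → length β P ≤ length β Q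

/-- A geodesic from `A` to `B`: a length-minimizing curve parametrized proportionally to
arc length. -/
def IsGeodesic (β : ℝ) (A B : Matrix (Fin n) (Fin n) ℝ)
    (P : ℝ → Matrix (Fin n) (Fin n) ℝ) : Prop :=
  IsLengthMinimizing β A B P ∧ ∃ c : ℝ, ∀ t ∈ Icc (0 : ℝ) 1, speed β P t = c

/-- `G` is the unique geodesic from `A` to `B`: it is a geodesic, each geodesic from `A` to `B`
equals it on `[0,1]`, and each length-minimizing curve from `A` to `B`, however parametrized,
is a monotone reparametrization of it. -/
def IsUniqueGeodesic (β : ℝ) (A B : Matrix (Fin n) (Fin n) ℝ)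
    (G : ℝ → Matrix (Fin n) (Fin n) ℝ) : Prop :=
  IsGeodesic β A B G ∧
  (∀ P : ℝ → Matrix (Fin n) (Fin n) ℝ, IsGeodesic β A B P → EqOn P G (Icc 0 1)) ∧
  (∀ P : ℝ → Matrix (Fin n) (Fin n) ℝ, IsLengthMinimizing β A B P →
    ∃ φ : ℝ → ℝ, ContinuousOn φ (Icc 0 1) ∧ MonotoneOn φ (Icc 0 1) ∧ φ 0 = 0 ∧ φ 1 = 1 ∧
      ∀ t ∈ Icc (0 : ℝ) 1, P t = G (φ t))

/-! ### The quantities in the explicit formula -/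

/-- `δ(M, N) = (∑ᵢ ln² λᵢ)^{1/2}`, with `λᵢ` the eigenvalues of `M⁻¹ N` with multiplicity. -/
def delta (M N : Matrix (Fin n) (Fin n) ℝ) : ℝ :=
  √(((M⁻¹ * N).charpoly.roots.map fun x => Real.log x ^ 2).sum)

/-- `d = δ(Ã, B̃)`, where `X̃ = det(X)^{-1/n} X` has determinant one. -/
def dist₁ (A B : Matrix (Fin n) (Fin n) ℝ) : ℝ :=
  delta (A.det ^ (-(1 / (n : ℝ))) • A) (B.det ^ (-(1 / (n : ℝ))) • B)

/-- `γ_β(A, B) = |β| d / (2 √(1/n - β))`. -/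
def gamma (β : ℝ) (A B : Matrix (Fin n) (Fin n) ℝ) : ℝ :=
  |β| * dist₁ A B / (2 * √(1 / (n : ℝ) - β))

def beta₁ (A B : Matrix (Fin n) (Fin n) ℝ) : ℝ :=
  -Real.pi * ((√(Real.pi ^ 2 * n ^ 2 + 4 * n * dist₁ A B ^ 2) + Real.pi * n)
    / (2 * n * dist₁ A B ^ 2))

def beta₂ (A B : Matrix (Fin n) (Fin n) ℝ) : ℝ :=
  Real.pi * ((√(Real.pi ^ 2 * n ^ 2 + 4 * n * dist₁ A B ^ 2) - Real.pi * n)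
    / (2 * n * dist₁ A B ^ 2))

/-- `σ = det(A⁻¹ B)^{β/2}`. -/
def sigma (β : ℝ) (A B : Matrix (Fin n) (Fin n) ℝ) : ℝ :=
  (A⁻¹ * B).det ^ (β / 2)

def alpha (β : ℝ) (A B : Matrix (Fin n) (Fin n) ℝ) (t : ℝ) : ℝ :=
  1 / gamma β A B * Real.arctan
    (t * sigma β A B * Real.sin (gamma β A B)
      / (1 - t + t * sigma β A B * Real.cos (gamma β A B)))

def eta (β : ℝ) (A B : Matrix (Fin n) (Fin n) ℝ) (t : ℝ) : ℝ :=
  (((1 - t) ^ 2 + 2 * t * (1 - t) * sigma β A B * Real.cos (gamma β A B)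
      + t ^ 2 * sigma β A B ^ 2)
    / sigma β A B ^ (2 * alpha β A B t)) ^ (1 / (n * β))

end PowerCone

end

/-!
The power metric makes the positive definite matrices a cone over those of determinant one. With
`X = det(X)^{1/n} Y` and `L = ln det X` it reads `det(X)^β ((1/n - β) dL² + |dY|²)`, where `|dY|` is the
trace metric. So a geodesic line in the determinant one slice spans a flat plane, with
polar coordinates `r = det(X)^{β/2}` and `θ = k w`, where `w` is arc length on the line and
`k = |β| / (2 √(1/n - β))`; multiplication by `k` turns the length in the power metric into Euclidean
length. The geodesics are the straight segments in such planes, and `γ < π/2` keeps the segment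
in the right half-plane, where `θ` is an arctangent.

A congruence, which is a homothety of the metric (`metric_conj`), reduces to curves from `1` to a
diagonal matrix (`exists_simultaneous_diagonalization`). To bound the length of such a curve from
below, write it as `U diag(exp x) Uᵀ` with `U` unit lower triangular and `U`, `x` of class `C¹`
(`exists_contDiffOn_ldl`). Forgetting `U` does not increase the speed, and strictly decreases it
where `U` moves (`ldl_velocity`); neither does projecting `x` to the plane of the two directions
`(1, …, 1)` and `v`, the normalized traceless part of the endpoint (`sum_sq_decomposition`). This
develops any curve into the Euclidean plane without increasing its length
(`IsCurve.exists_planar_development`), and there the segment is shortest (`planar_length`). If a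
curve is as short as the segment, then all these inequalities are equalities: the curve is diagonal,
lies over the plane, and its development runs monotonically through the segment, which is the
uniqueness claim (`isUniqueGeodesic_segmentCurve`).
-/

namespace PowerCone

/-! ### Continuously differentiable `LDLᵀ` factorization -/

/-- The Schur complement of the upper left entry of a positive definite matrix is positive
definite. -/
theorem posDef_schur {m : ℕ} {X : Matrix (Fin (m + 1)) (Fin (m + 1)) ℝ} (hX : X.PosDef) :
    (Matrix.of fun i j : Fin m =>
      X i.succ j.succ - X i.succ 0 * X j.succ 0 / X 0 0).PosDef := by
  have ha : X 0 0 ≠ 0 := hX.diag_pos.ne'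
  have hs : ∀ i j, X i j = X j i := fun i j => by
    simpa using (hX.isHermitian.apply i j).symm
  refine PosDef.of_dotProduct_mulVec_pos ?_ fun y hy => ?_
  · ext i j
    simp [hs j.succ i.succ, mul_comm]
  -- the minimizer of the quadratic form of `X` over the vectors extending `y`
  have h := hX.dotProduct_mulVec_pos
    (x := (Fin.cons (-(∑ j, X j.succ 0 * y j) / X 0 0) y : Fin (m + 1) → ℝ)) (by
      intro h0
      apply hy
      funext i
      simpa using congrFun h0 i.succ)
  have e : star (Fin.cons (-(∑ j, X j.succ 0 * y j) / X 0 0) y : Fin (m + 1) → ℝ) ⬝ᵥ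
      (X *ᵥ (Fin.cons (-(∑ j, X j.succ 0 * y j) / X 0 0) y : Fin (m + 1) → ℝ)) =
      star y ⬝ᵥ ((Matrix.of fun i j : Fin m =>
        X i.succ j.succ - X i.succ 0 * X j.succ 0 / X 0 0) *ᵥ y) := by
    simp only [star_trivial, dotProduct, mulVec, Fin.sum_univ_succ, Fin.cons_zero, Fin.cons_succ,
      of_apply, sub_mul, Finset.sum_sub_distrib, mul_add, mul_sub, Finset.sum_add_distrib]
    simp only [hs 0 (Fin.succ _)]
    set b := ∑ j, X j.succ 0 * y j with hb
    have h1 : ∑ i, y i * (X i.succ 0 * (-b / X 0 0)) = -b ^ 2 / X 0 0 := by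
      have : ∀ i, y i * (X i.succ 0 * (-b / X 0 0)) = X i.succ 0 * y i * (-b / X 0 0) :=
        fun i => by ring
      rw [Finset.sum_congr rfl fun i _ => this i, ← Finset.sum_mul, ← hb]
      ring
    have h2 : ∑ i, y i * ∑ j, X i.succ 0 * X j.succ 0 / X 0 0 * y j = b ^ 2 / X 0 0 := by
      rw [sq, hb, Finset.sum_mul, Finset.sum_div]
      refine Finset.sum_congr rfl fun i _ => ?_
      rw [Finset.mul_sum, Finset.mul_sum, Finset.sum_div]
      refine Finset.sum_congr rfl fun j _ => by ring
    rw [h1, h2]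
    field_simp
    ring
  rwa [e] at h

/-- A `C¹` family of positive definite matrices has a `C¹` factorization `U diag(exp x) Uᵀ` with `U`
unit lower triangular. The induction splits off the first row and column. The last clause is the
uniqueness of the factorization at diagonal matrices, which fixes `U` and `x` at the endpoints of
the curves considered below. -/
theorem exists_contDiffOn_ldl {m : ℕ} {s : Set ℝ} (X : ℝ → Matrix (Fin m) (Fin m) ℝ)
    (hpd : ∀ t ∈ s, (X t).PosDef) (hX : ∀ i j, ContDiffOn ℝ 1 (fun t => X t i j) s) :
    ∃ (U : ℝ → Matrix (Fin m) (Fin m) ℝ) (x : ℝ → Fin m → ℝ),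
      (∀ i j, ContDiffOn ℝ 1 (fun t => U t i j) s) ∧
      (∀ i, ContDiffOn ℝ 1 (fun t => x t i) s) ∧
      (∀ t i, U t i i = 1) ∧ (∀ t i j, i < j → U t i j = 0) ∧
      (∀ t ∈ s, ∀ i j, X t i j = ∑ k, Real.exp (x t k) * U t i k * U t j k) ∧
      (∀ t ∈ s, ∀ f : Fin m → ℝ, X t = diagonal (fun i => Real.exp (f i)) →
        U t = 1 ∧ x t = f) := by
  induction m with
  | zero =>
    exact ⟨fun _ => 1, fun _ _ => 0, fun i => i.elim0, fun i => i.elim0, fun _ i => i.elim0,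
      fun _ i => i.elim0, fun _ _ i => i.elim0,
      fun _ _ _ _ => ⟨rfl, funext fun i => i.elim0⟩⟩
  | succ m ih =>
    have ha : ∀ t ∈ s, 0 < X t 0 0 := fun t ht => (hpd t ht).diag_pos
    have hs : ∀ t ∈ s, ∀ i j, X t i j = X t j i := fun t ht i j => by
      simpa using ((hpd t ht).isHermitian.apply i j).symm
    obtain ⟨V, y, hV, hy, hV1, hV0, hVX, hVd⟩ := ih
      (fun t => Matrix.of fun i j : Fin m =>
        X t i.succ j.succ - X t i.succ 0 * X t j.succ 0 / X t 0 0)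
      (fun t ht => posDef_schur (hpd t ht))
      (fun i j => (hX _ _).sub (((hX _ _).mul (hX _ _)).div (hX _ _) fun t ht => (ha t ht).ne'))
    refine ⟨fun t => Matrix.of (Fin.cons (Fin.cons 1 0)
        fun i => Fin.cons (X t i.succ 0 / X t 0 0) (V t i)),
      fun t => Fin.cons (Real.log (X t 0 0)) (y t), ?_, ?_, ?_, ?_, ?_, ?_⟩
    · intro i j
      refine Fin.cases ?_ (fun i => ?_) i <;> refine Fin.cases ?_ (fun j => ?_) j
      · simpa using contDiffOn_const
      · simpa using contDiffOn_const
      · have h : ContDiffOn ℝ 1 (fun t => X t i.succ 0 / X t 0 0) s :=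
          (hX i.succ 0).div (hX 0 0) fun t ht => (ha t ht).ne'
        simpa using h
      · simpa using hV i j
    · intro i
      refine Fin.cases ?_ (fun i => ?_) i
      · simpa using (hX 0 0).log fun t ht => (ha t ht).ne'
      · simpa using hy i
    · intro t i
      refine Fin.cases ?_ (fun i => ?_) i
      · simp
      · simpa using hV1 t i
    · intro t i j
      refine Fin.cases ?_ (fun i => ?_) i <;> refine Fin.cases ?_ (fun j => ?_) j
      · simp
      · simp
      · simp
      · simpa using hV0 t i j
    · intro t ht i j
      have h0 := (ha t ht).ne'
      refine Fin.cases ?_ (fun i => ?_) i <;> refine Fin.cases ?_ (fun j => ?_) j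
      · simp [Fin.sum_univ_succ, Real.exp_log (ha t ht)]
      · simp [Fin.sum_univ_succ, Real.exp_log (ha t ht), hs t ht 0 j.succ]
        field_simp
      · simp [Fin.sum_univ_succ, Real.exp_log (ha t ht)]
        field_simp
      · have := hVX t ht i j
        simp only [of_apply] at this
        simp [Fin.sum_univ_succ, Real.exp_log (ha t ht), ← this]
        field_simp
        ring
    · intro t ht f hf
      have hb : ∀ i : Fin m, X t i.succ 0 = 0 := fun i => by
        rw [hf, diagonal_apply_ne _ (Fin.succ_ne_zero i)]
      obtain ⟨h1, h2⟩ := hVd t ht (fun i => f i.succ) (by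
        ext i j
        simp only [of_apply, hb, hf]
        simp [diagonal_apply])
      constructor
      · ext i j
        refine Fin.cases ?_ (fun i => ?_) i <;> refine Fin.cases ?_ (fun j => ?_) j
        · simp
        · simp [one_apply, (Fin.succ_ne_zero _).symm]
        · simp [hb]
        · simp [h1, one_apply]
      · funext i
        refine Fin.cases ?_ (fun i => ?_) i
        · simp [hf]
        · simp [h2]

/-! ### The metric in the coordinates of the factorization -/

/-- Here `T = D⁻¹ S` with `D = diag(exp x)` and `S = N D + D diag(x') + D Nᵀ` symmetric, so that
`tr T² = ∑ᵢⱼ Sᵢⱼ² / (Dᵢ Dⱼ)` is at least its diagonal part. -/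
theorem trace_sq_diag_add {m : ℕ} (x x' : Fin m → ℝ) (N : Matrix (Fin m) (Fin m) ℝ)
    (hN : ∀ i j, i ≤ j → N i j = 0) (T : Matrix (Fin m) (Fin m) ℝ)
    (hT : ∀ i j, T i j = N j i + diagonal x' i j + Real.exp (x j - x i) * N i j) :
    T.trace = ∑ i, x' i ∧ ∑ i, x' i ^ 2 ≤ (T * T).trace ∧
      ((T * T).trace = ∑ i, x' i ^ 2 → N = 0) := by
  have hd : ∀ i, T i i = x' i := fun i => by simp [hT, hN]
  have hsym : ∀ i j, T j i = Real.exp (x i - x j) * T i j := by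
    intro i j
    by_cases h : i = j
    · subst h; simp
    · have : Real.exp (x i - x j) * Real.exp (x j - x i) = 1 := by
        rw [← Real.exp_add]; simp
      rw [hT, hT, diagonal_apply_ne _ h, diagonal_apply_ne _ (Ne.symm h)]
      linear_combination -N i j * this
  have hterm : ∀ i j, T i j * T j i = Real.exp (x i - x j) * T i j ^ 2 := fun i j => by
    rw [hsym i j]; ring
  have htr : (T * T).trace = ∑ i, ∑ j, Real.exp (x i - x j) * T i j ^ 2 := by
    simp only [trace, diag_apply, mul_apply, hterm]
  have hrow : ∀ i, x' i ^ 2 ≤ ∑ j, Real.exp (x i - x j) * T i j ^ 2 := fun i => by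
    have := Finset.single_le_sum (f := fun j => Real.exp (x i - x j) * T i j ^ 2)
      (fun j _ => by positivity) (Finset.mem_univ i)
    simpa [hd] using this
  refine ⟨by simp [trace, hd], ?_, fun h => ?_⟩
  · rw [htr]
    exact Finset.sum_le_sum fun i _ => hrow i
  · rw [htr] at h
    have h1 := (Finset.sum_eq_sum_iff_of_le fun i _ => hrow i).1 h.symm
    ext i j
    rcases le_or_gt i j with hij | hij
    · simpa using hN i j hij
    · have h2 := h1 i (Finset.mem_univ i)
      have h3 := Finset.add_le_sum (f := fun j => Real.exp (x i - x j) * T i j ^ 2)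
        (fun j _ => by positivity) (Finset.mem_univ i) (Finset.mem_univ j) hij.ne'
      simp only [hd, sub_self, Real.exp_zero, one_mul] at h3
      have h4 : Real.exp (x i - x j) * T i j ^ 2 = 0 :=
        le_antisymm (by linarith) (by positivity)
      have h5 : T i j = 0 := by simpa using h4
      rw [hT, hN j i hij.le, diagonal_apply_ne _ hij.ne'] at h5
      simpa using h5

/-- For `X = U diag(exp x) Uᵀ` the map `X ↦ x` does not increase the trace metric, and it preserves the
length of a tangent vector only if the triangular factor does not move. -/
theorem ldl_velocity {m : ℕ} (x x' : Fin m → ℝ) (U U' X X' : Matrix (Fin m) (Fin m) ℝ)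
    (hU1 : ∀ i, U i i = 1) (hU0 : ∀ i j, i < j → U i j = 0) (hU' : ∀ i j, i ≤ j → U' i j = 0)
    (hX : X = U * diagonal (fun i => Real.exp (x i)) * Uᵀ)
    (hX' : X' = U' * diagonal (fun i => Real.exp (x i)) * Uᵀ +
      U * diagonal (fun i => Real.exp (x i) * x' i) * Uᵀ +
      U * diagonal (fun i => Real.exp (x i)) * U'ᵀ) :
    X.det = Real.exp (∑ i, x i) ∧ (X⁻¹ * X').trace = ∑ i, x' i ∧
      ∑ i, x' i ^ 2 ≤ (X⁻¹ * X' * X⁻¹ * X').trace ∧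
      ((X⁻¹ * X' * X⁻¹ * X').trace = ∑ i, x' i ^ 2 → U' = 0) := by
  have hUt : U.BlockTriangular OrderDual.toDual := fun i j h => hU0 i j h
  have hUdet : U.det = 1 := by
    rw [det_of_isLowerTriangular U hUt]; simp [hU1]
  have hUu : IsUnit U.det := by simp [hUdet]
  have : Invertible U := U.invertibleOfIsUnitDet hUu
  have hVt : U⁻¹.BlockTriangular OrderDual.toDual := blockTriangular_inv_of_blockTriangular hUt
  set D : Matrix (Fin m) (Fin m) ℝ := diagonal fun i => Real.exp (x i) with hD
  set E : Matrix (Fin m) (Fin m) ℝ := diagonal fun i => Real.exp (-x i) with hE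
  have hED : E * D = 1 := by
    rw [hE, hD, diagonal_mul_diagonal]
    simp [← Real.exp_add]
  have hDd : diagonal (fun i => Real.exp (x i) * x' i) = D * diagonal x' := by
    rw [hD, diagonal_mul_diagonal]
  set N := U⁻¹ * U' with hNdef
  have hUN : U' = U * N := by rw [hNdef, mul_nonsing_inv_cancel_left _ _ hUu]
  have hN : ∀ i j, i ≤ j → N i j = 0 := fun i j hij => by
    rw [hNdef, mul_apply]
    refine Finset.sum_eq_zero fun k _ => ?_
    rcases le_or_gt k i with hk | hk
    · rw [hU' k j (hk.trans hij), mul_zero]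
    · rw [hVt (show OrderDual.toDual k < OrderDual.toDual i from hk), zero_mul]
  set T := Nᵀ + diagonal x' + E * N * D with hTdef
  have hXi : X⁻¹ = (U⁻¹)ᵀ * E * U⁻¹ := by
    apply inv_eq_left_inv
    rw [hX]
    calc (U⁻¹)ᵀ * E * U⁻¹ * (U * D * Uᵀ) = (U⁻¹)ᵀ * E * (U⁻¹ * U) * D * Uᵀ := by
          simp only [Matrix.mul_assoc]
      _ = (U⁻¹)ᵀ * (E * D) * Uᵀ := by
          rw [nonsing_inv_mul _ hUu]; simp only [Matrix.mul_assoc, Matrix.one_mul]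
      _ = 1 := by rw [hED, Matrix.mul_one, ← transpose_mul, mul_nonsing_inv _ hUu, transpose_one]
  have hX'' : X' = U * (D * T) * Uᵀ := by
    have hDE : D * E = 1 := mul_eq_one_comm.1 hED
    rw [hX', hDd, hUN, hTdef, Matrix.mul_add, Matrix.mul_add, ← Matrix.mul_assoc D (E * N) D,
      ← Matrix.mul_assoc D E N, hDE, Matrix.one_mul, transpose_mul]
    simp only [Matrix.mul_add, Matrix.add_mul, Matrix.mul_assoc]
    abel
  have hM : X⁻¹ * X' = (U⁻¹)ᵀ * T * Uᵀ := by
    rw [hXi, hX'']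
    calc (U⁻¹)ᵀ * E * U⁻¹ * (U * (D * T) * Uᵀ) = (U⁻¹)ᵀ * E * (U⁻¹ * U) * D * T * Uᵀ := by
          simp only [Matrix.mul_assoc]
      _ = (U⁻¹)ᵀ * (E * D) * T * Uᵀ := by
          rw [nonsing_inv_mul _ hUu]; simp only [Matrix.mul_assoc, Matrix.one_mul]
      _ = _ := by rw [hED, Matrix.mul_one]
  have hUUt : Uᵀ * (U⁻¹)ᵀ = 1 := by rw [← transpose_mul, nonsing_inv_mul _ hUu, transpose_one]
  have ht1 : (X⁻¹ * X').trace = T.trace := by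
    rw [hM, trace_mul_comm, ← Matrix.mul_assoc, hUUt, Matrix.one_mul]
  have ht2 : (X⁻¹ * X' * X⁻¹ * X').trace = (T * T).trace := by
    rw [Matrix.mul_assoc (X⁻¹ * X'), hM]
    have : (U⁻¹)ᵀ * T * Uᵀ * ((U⁻¹)ᵀ * T * Uᵀ) = (U⁻¹)ᵀ * (T * (Uᵀ * (U⁻¹)ᵀ) * T) * Uᵀ := by
      simp only [Matrix.mul_assoc]
    rw [this, hUUt, Matrix.mul_one, trace_mul_comm, ← Matrix.mul_assoc, hUUt, Matrix.one_mul]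
  have hTij : ∀ i j, T i j = N j i + diagonal x' i j + Real.exp (x j - x i) * N i j := fun i j => by
    simp only [hTdef, hE, hD, Matrix.add_apply, transpose_apply, mul_diagonal, diagonal_mul, sub_eq_add_neg,
      Real.exp_add]
    ring
  obtain ⟨h1, h2, h3⟩ := trace_sq_diag_add x x' N hN T hTij
  refine ⟨?_, ht1.trans h1, ht2 ▸ h2, fun h => ?_⟩
  · rw [hX, det_mul, det_mul, det_transpose, hUdet, hD, det_diagonal, Real.exp_sum]
    simp
  · rw [hUN, h3 (ht2 ▸ h), Matrix.mul_zero]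

/-! ### Invariance under congruence -/

theorem velocity_eq {m : ℕ} {P : ℝ → Matrix (Fin m) (Fin m) ℝ} {V : Matrix (Fin m) (Fin m) ℝ}
    {t : ℝ} (ht : t ∈ Icc (0 : ℝ) 1)
    (h : ∀ i j, HasDerivWithinAt (fun s => P s i j) (V i j) (Icc 0 1) t) : velocity P t = V := by
  ext i j
  exact (h i j).derivWithin (uniqueDiffOn_Icc zero_lt_one t ht)

theorem IsCurve.hasDerivWithinAt {m : ℕ} {A B : Matrix (Fin m) (Fin m) ℝ}
    {P : ℝ → Matrix (Fin m) (Fin m) ℝ} (h : IsCurve A B P) {t : ℝ} (ht : t ∈ Icc (0 : ℝ) 1)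
    (i j : Fin m) : HasDerivWithinAt (fun s => P s i j) (velocity P t i j) (Icc 0 1) t :=
  (((h.contDiffOn i j).differentiableOn (by norm_num)) t ht).hasDerivWithinAt

theorem conj_apply {m : ℕ} (C X : Matrix (Fin m) (Fin m) ℝ) (i j : Fin m) :
    (C * X * Cᵀ) i j = ∑ k, ∑ l, C i l * X l k * C j k := by
  simp only [mul_apply, transpose_apply, Finset.sum_mul]

theorem conj_inv_conj {m : ℕ} {C : Matrix (Fin m) (Fin m) ℝ} (hC : IsUnit C)
    (X : Matrix (Fin m) (Fin m) ℝ) : C * (C⁻¹ * X * C⁻¹ᵀ) * Cᵀ = X := by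
  have h := (isUnit_iff_isUnit_det C).1 hC
  calc C * (C⁻¹ * X * C⁻¹ᵀ) * Cᵀ = (C * C⁻¹) * X * (C * C⁻¹)ᵀ := by
        simp only [transpose_mul, Matrix.mul_assoc]
    _ = X := by rw [mul_nonsing_inv _ h]; simp

theorem inv_conj_conj {m : ℕ} {C : Matrix (Fin m) (Fin m) ℝ} (hC : IsUnit C)
    (X : Matrix (Fin m) (Fin m) ℝ) : C⁻¹ * (C * X * Cᵀ) * C⁻¹ᵀ = X := by
  have h := (isUnit_iff_isUnit_det C).1 hC
  calc C⁻¹ * (C * X * Cᵀ) * C⁻¹ᵀ = (C⁻¹ * C) * X * (C⁻¹ * C)ᵀ := by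
        simp only [transpose_mul, Matrix.mul_assoc]
    _ = X := by rw [nonsing_inv_mul _ h]; simp

/-- Congruence by `C` is a homothety of the power metric. -/
theorem metric_conj {m : ℕ} (β : ℝ) {C : Matrix (Fin m) (Fin m) ℝ} (hC : IsUnit C)
    {X : Matrix (Fin m) (Fin m) ℝ} (hX : 0 < X.det) (H K : Matrix (Fin m) (Fin m) ℝ) :
    metric β (C * X * Cᵀ) (C * H * Cᵀ) (C * K * Cᵀ) = (C.det ^ 2) ^ β * metric β X H K := by
  have h := (isUnit_iff_isUnit_det C).1 hC
  have ht : Cᵀ⁻¹ᵀ = C⁻¹ := by rw [transpose_nonsing_inv, transpose_transpose]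
  have htu : Cᵀ * Cᵀ⁻¹ = 1 := mul_nonsing_inv _ (by rwa [det_transpose])
  have e : ∀ H, (C * X * Cᵀ)⁻¹ * (C * H * Cᵀ) = Cᵀ⁻¹ * (X⁻¹ * H) * Cᵀ := fun H => by
    rw [Matrix.mul_inv_rev, Matrix.mul_inv_rev]
    calc Cᵀ⁻¹ * (X⁻¹ * C⁻¹) * (C * H * Cᵀ) = Cᵀ⁻¹ * X⁻¹ * (C⁻¹ * C) * H * Cᵀ := by
          simp only [Matrix.mul_assoc]
      _ = _ := by rw [nonsing_inv_mul _ h]; simp only [Matrix.mul_assoc, Matrix.one_mul]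
  have tr : ∀ M : Matrix (Fin m) (Fin m) ℝ, (Cᵀ⁻¹ * M * Cᵀ).trace = M.trace := fun M => by
    rw [trace_mul_comm, ← Matrix.mul_assoc, htu, Matrix.one_mul]
  have e2 : (C * X * Cᵀ)⁻¹ * (C * H * Cᵀ) * (C * X * Cᵀ)⁻¹ * (C * K * Cᵀ)
      = Cᵀ⁻¹ * (X⁻¹ * H * X⁻¹ * K) * Cᵀ := by
    rw [Matrix.mul_assoc (_ * _), e, e]
    calc Cᵀ⁻¹ * (X⁻¹ * H) * Cᵀ * (Cᵀ⁻¹ * (X⁻¹ * K) * Cᵀ)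
        = Cᵀ⁻¹ * (X⁻¹ * H) * (Cᵀ * Cᵀ⁻¹) * (X⁻¹ * K) * Cᵀ := by simp only [Matrix.mul_assoc]
      _ = _ := by rw [htu]; simp only [Matrix.mul_assoc, Matrix.one_mul]
  have hdet : (C * X * Cᵀ).det = C.det ^ 2 * X.det := by
    rw [det_mul, det_mul, det_transpose]; ring
  rw [metric, e2, e, e, tr, tr, tr, hdet, Real.mul_rpow (sq_nonneg _) hX.le, metric]
  ring

theorem IsCurve.conj {m : ℕ} {A B C : Matrix (Fin m) (Fin m) ℝ}
    {P : ℝ → Matrix (Fin m) (Fin m) ℝ} (hC : IsUnit C) (h : IsCurve A B P) :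
    IsCurve (C * A * Cᵀ) (C * B * Cᵀ) fun t => C * P t * Cᵀ where
  posDef t ht := by
    have := (IsUnit.posDef_star_right_conjugate_iff hC).2 (h.posDef t ht)
    rwa [star_eq_conjTranspose, conjTranspose_eq_transpose_of_trivial] at this
  contDiffOn i j := by
    simp only [conj_apply]
    exact ContDiffOn.sum fun k _ => ContDiffOn.sum fun l _ =>
      (contDiffOn_const.mul (h.contDiffOn l k)).mul contDiffOn_const
  source := by simp [h.source]
  target := by simp [h.target]

theorem IsCurve.speed_conj {m : ℕ} {A B C : Matrix (Fin m) (Fin m) ℝ} (β : ℝ)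
    {P : ℝ → Matrix (Fin m) (Fin m) ℝ} (hC : IsUnit C) (h : IsCurve A B P) {t : ℝ}
    (ht : t ∈ Icc (0 : ℝ) 1) :
    speed β (fun t => C * P t * Cᵀ) t = √((C.det ^ 2) ^ β) * speed β P t := by
  have hv : velocity (fun t => C * P t * Cᵀ) t = C * velocity P t * Cᵀ := by
    refine velocity_eq ht fun i j => ?_
    simp only [conj_apply]
    exact HasDerivWithinAt.fun_sum fun k _ => HasDerivWithinAt.fun_sum fun l _ =>
      ((h.hasDerivWithinAt ht l k).const_mul _).mul_const _
  rw [speed, hv, metric_conj β hC (h.posDef t ht).det_pos, speed,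
    Real.sqrt_mul (Real.rpow_nonneg (sq_nonneg _) _)]

theorem IsCurve.length_conj {m : ℕ} {A B C : Matrix (Fin m) (Fin m) ℝ} (β : ℝ)
    {P : ℝ → Matrix (Fin m) (Fin m) ℝ} (hC : IsUnit C) (h : IsCurve A B P) :
    length β (fun t => C * P t * Cᵀ) = √((C.det ^ 2) ^ β) * length β P := by
  rw [length, length, ← intervalIntegral.integral_const_mul]
  refine intervalIntegral.integral_congr fun t ht => ?_
  rw [uIcc_of_le zero_le_one] at ht
  exact h.speed_conj β hC ht

theorem IsLengthMinimizing.conj {m : ℕ} {A B C : Matrix (Fin m) (Fin m) ℝ} {β : ℝ}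
    {P : ℝ → Matrix (Fin m) (Fin m) ℝ} (hC : IsUnit C) (h : IsLengthMinimizing β A B P) :
    IsLengthMinimizing β (C * A * Cᵀ) (C * B * Cᵀ) fun t => C * P t * Cᵀ := by
  refine ⟨h.1.conj hC, fun Q hQ => ?_⟩
  have hCi : IsUnit C⁻¹ := (isUnit_nonsing_inv_iff).2 hC
  have hQ' := hQ.conj hCi
  rw [inv_conj_conj hC, inv_conj_conj hC] at hQ'
  have e : (fun t => C * (C⁻¹ * Q t * C⁻¹ᵀ) * Cᵀ) = Q := funext fun t => conj_inv_conj hC _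
  rw [h.1.length_conj β hC, ← e, hQ'.length_conj β hC]
  exact mul_le_mul_of_nonneg_left (h.2 _ hQ') (Real.sqrt_nonneg _)

theorem IsGeodesic.conj {m : ℕ} {A B C : Matrix (Fin m) (Fin m) ℝ} {β : ℝ}
    {P : ℝ → Matrix (Fin m) (Fin m) ℝ} (hC : IsUnit C) (h : IsGeodesic β A B P) :
    IsGeodesic β (C * A * Cᵀ) (C * B * Cᵀ) fun t => C * P t * Cᵀ := by
  obtain ⟨hP, c, hc⟩ := h
  exact ⟨hP.conj hC, √((C.det ^ 2) ^ β) * c, fun t ht => by rw [hP.1.speed_conj β hC ht, hc t ht]⟩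

theorem IsUniqueGeodesic.conj {m : ℕ} {A B C : Matrix (Fin m) (Fin m) ℝ} {β : ℝ}
    {G : ℝ → Matrix (Fin m) (Fin m) ℝ} (hC : IsUnit C) (h : IsUniqueGeodesic β A B G) :
    IsUniqueGeodesic β (C * A * Cᵀ) (C * B * Cᵀ) fun t => C * G t * Cᵀ := by
  have hCi : IsUnit C⁻¹ := (isUnit_nonsing_inv_iff).2 hC
  refine ⟨h.1.conj hC, fun P hP t ht => ?_, fun P hP => ?_⟩
  · have hP' := hP.conj hCi
    rw [inv_conj_conj hC, inv_conj_conj hC] at hP'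
    simp only [← h.2.1 _ hP' ht, conj_inv_conj hC]
  · have hP' := hP.conj hCi
    rw [inv_conj_conj hC, inv_conj_conj hC] at hP'
    obtain ⟨φ, h1, h2, h3, h4, h5⟩ := h.2.2 _ hP'
    exact ⟨φ, h1, h2, h3, h4, fun t ht => by simp only [← h5 t ht, conj_inv_conj hC]⟩

theorem velocity_congr {m : ℕ} {P Q : ℝ → Matrix (Fin m) (Fin m) ℝ} (h : EqOn P Q (Icc 0 1))
    {t : ℝ} (ht : t ∈ Icc (0 : ℝ) 1) : velocity P t = velocity Q t := by
  ext i j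
  exact derivWithin_congr (fun s hs => by rw [h hs]) (by rw [h ht])

theorem speed_congr {m : ℕ} (β : ℝ) {P Q : ℝ → Matrix (Fin m) (Fin m) ℝ}
    (h : EqOn P Q (Icc 0 1)) {t : ℝ} (ht : t ∈ Icc (0 : ℝ) 1) : speed β P t = speed β Q t := by
  rw [speed, speed, velocity_congr h ht, h ht]

theorem length_congr {m : ℕ} (β : ℝ) {P Q : ℝ → Matrix (Fin m) (Fin m) ℝ}
    (h : EqOn P Q (Icc 0 1)) : length β P = length β Q := by
  refine intervalIntegral.integral_congr fun t ht => ?_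
  rw [uIcc_of_le zero_le_one] at ht
  exact speed_congr β h ht

/-- Being the unique geodesic depends only on the values on `[0,1]`. -/
theorem IsUniqueGeodesic.congr {m : ℕ} {A B : Matrix (Fin m) (Fin m) ℝ} {β : ℝ}
    {F G : ℝ → Matrix (Fin m) (Fin m) ℝ} (hG : IsUniqueGeodesic β A B G)
    (h : EqOn F G (Icc 0 1)) : IsUniqueGeodesic β A B F := by
  obtain ⟨⟨⟨hc, hm⟩, c, hs⟩, hu, hr⟩ := hG
  refine ⟨⟨⟨⟨fun t ht => h ht ▸ hc.posDef t ht, fun i j => (hc.contDiffOn i j).congr fun t ht => ?_,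
    (h (left_mem_Icc.2 zero_le_one)).trans hc.source,
    (h (right_mem_Icc.2 zero_le_one)).trans hc.target⟩, fun Q hQ => ?_⟩, c, fun t ht => ?_⟩,
    fun P hP t ht => ?_, fun P hP => ?_⟩
  · rw [h ht]
  · rw [length_congr β h]; exact hm Q hQ
  · rw [speed_congr β h ht]; exact hs t ht
  · rw [hu P hP ht, h ht]
  · obtain ⟨φ, h1, h2, h3, h4, h5⟩ := hr P hP
    refine ⟨φ, h1, h2, h3, h4, fun t ht => ?_⟩
    rw [h5 t ht, h ⟨h3 ▸ h2 (left_mem_Icc.2 zero_le_one) ht ht.1,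
      h4 ▸ h2 ht (right_mem_Icc.2 zero_le_one) ht.2⟩]

/-! ### Shortest curves in the Euclidean plane -/

theorem eqOn_zero_of_integral_nonpos {g : ℝ → ℝ} (hg : ContinuousOn g (Icc 0 1))
    (h0 : ∀ t ∈ Icc (0 : ℝ) 1, 0 ≤ g t) (hi : ∫ t in (0 : ℝ)..1, g t ≤ 0) :
    ∀ t ∈ Icc (0 : ℝ) 1, g t = 0 := by
  by_contra! hne
  obtain ⟨c, hc, hcne⟩ := hne
  have h := intervalIntegral.integral_lt_integral_of_continuousOn_of_le_of_exists_lt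
    (f := fun _ => (0 : ℝ)) (g := g) zero_lt_one continuousOn_const hg
    (fun x hx => h0 x (Ioc_subset_Icc_self hx)) ⟨c, hc, lt_of_le_of_ne (h0 c hc) (Ne.symm hcne)⟩
  simp only [intervalIntegral.integral_zero] at h
  linarith

theorem exists_unit_direction (u w : ℝ) :
    ∃ a b : ℝ, a ^ 2 + b ^ 2 = 1 ∧ u = √(u ^ 2 + w ^ 2) * a ∧ w = √(u ^ 2 + w ^ 2) * b := by
  rcases eq_or_ne (√(u ^ 2 + w ^ 2)) 0 with h | h
  · have h1 : u ^ 2 + w ^ 2 = 0 := by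
      rw [Real.sqrt_eq_zero (by positivity)] at h; exact h
    refine ⟨1, 0, by norm_num, ?_, ?_⟩
    · rw [h]; nlinarith [sq_nonneg u, sq_nonneg w]
    · rw [h]; nlinarith [sq_nonneg u, sq_nonneg w]
  · refine ⟨u / √(u ^ 2 + w ^ 2), w / √(u ^ 2 + w ^ 2), ?_, ?_, ?_⟩
    · have := Real.sq_sqrt (show 0 ≤ u ^ 2 + w ^ 2 by positivity)
      rw [div_pow, div_pow, ← add_div, this, div_self]
      rw [← this]; positivity
    · field_simp
    · field_simp

theorem contDiffOn_hasDerivWithinAt {p : ℝ → ℝ} (hp : ContDiffOn ℝ 1 p (Icc 0 1)) {t : ℝ}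
    (ht : t ∈ Icc (0 : ℝ) 1) : HasDerivWithinAt p (derivWithin p (Icc 0 1) t) (Icc 0 1) t :=
  ((hp.differentiableOn one_ne_zero) t ht).hasDerivWithinAt

theorem eq_of_hasDerivWithinAt_zero {g : ℝ → ℝ}
    (h : ∀ t ∈ Icc (0 : ℝ) 1, HasDerivWithinAt g 0 (Icc 0 1) t) :
    ∀ t ∈ Icc (0 : ℝ) 1, g t = g 0 :=
  constant_of_derivWithin_zero (fun t ht => (h t ht).differentiableWithinAt)
    fun t ht => (h t (Ico_subset_Icc_self ht)).derivWithin
      (uniqueDiffOn_Icc zero_lt_one t (Ico_subset_Icc_self ht))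

/-- If `s` dominates the speed of a plane curve `(p, q)`, then `∫ s` is at least the distance of the
endpoints. In the case of equality `s` is the speed, and the curve runs monotonically along the
segment between its endpoints, with parameter `φ`; if moreover `s` is constant, it does so with
constant speed. -/
theorem planar_length {p q s : ℝ → ℝ} (hp : ContDiffOn ℝ 1 p (Icc 0 1))
    (hq : ContDiffOn ℝ 1 q (Icc 0 1)) (hs : ContinuousOn s (Icc 0 1))
    (hs0 : ∀ t ∈ Icc (0 : ℝ) 1, 0 ≤ s t)
    (hle : ∀ t ∈ Icc (0 : ℝ) 1,
      derivWithin p (Icc 0 1) t ^ 2 + derivWithin q (Icc 0 1) t ^ 2 ≤ s t ^ 2) :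
    √((p 1 - p 0) ^ 2 + (q 1 - q 0) ^ 2) ≤ ∫ t in (0 : ℝ)..1, s t ∧
    (∫ t in (0 : ℝ)..1, s t ≤ √((p 1 - p 0) ^ 2 + (q 1 - q 0) ^ 2) →
      (∀ t ∈ Icc (0 : ℝ) 1,
        s t ^ 2 = derivWithin p (Icc 0 1) t ^ 2 + derivWithin q (Icc 0 1) t ^ 2) ∧
      ∃ φ : ℝ → ℝ, ContinuousOn φ (Icc 0 1) ∧ MonotoneOn φ (Icc 0 1) ∧ φ 0 = 0 ∧ φ 1 = 1 ∧
        (∀ t ∈ Icc (0 : ℝ) 1, p t = p 0 + φ t * (p 1 - p 0) ∧ q t = q 0 + φ t * (q 1 - q 0)) ∧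
        ((∃ c, ∀ t ∈ Icc (0 : ℝ) 1, s t = c) → ∀ t ∈ Icc (0 : ℝ) 1, φ t = t)) := by
  -- the proof projects to the unit vector `(a, b)` pointing from the start to the end
  obtain ⟨a, b, hab, hu, hw⟩ := exists_unit_direction (p 1 - p 0) (q 1 - q 0)
  set E := √((p 1 - p 0) ^ 2 + (q 1 - q 0) ^ 2) with hE
  set p' := derivWithin p (Icc 0 1) with hp'
  set q' := derivWithin q (Icc 0 1) with hq'
  have hp'c : ContinuousOn p' (Icc 0 1) :=
    hp.continuousOn_derivWithin (uniqueDiffOn_Icc zero_lt_one) le_rfl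
  have hq'c : ContinuousOn q' (Icc 0 1) :=
    hq.continuousOn_derivWithin (uniqueDiffOn_Icc zero_lt_one) le_rfl
  have hint : ∀ {g : ℝ → ℝ}, ContinuousOn g (Icc 0 1) →
      IntervalIntegrable g MeasureTheory.volume 0 1 := fun {g} hg =>
    ContinuousOn.intervalIntegrable (by rwa [uIcc_of_le zero_le_one])
  have hEint : ∫ t in (0 : ℝ)..1, (a * p' t + b * q' t) = E := by
    rw [intervalIntegral.integral_add ((hint hp'c).const_mul a) ((hint hq'c).const_mul b),
      intervalIntegral.integral_const_mul, intervalIntegral.integral_const_mul,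
      intervalIntegral.integral_derivWithin_Icc_of_contDiffOn_Icc hp zero_le_one,
      intervalIntegral.integral_derivWithin_Icc_of_contDiffOn_Icc hq zero_le_one]
    linear_combination a * hu + b * hw + E * hab
  have hproj : ∀ t ∈ Icc (0 : ℝ) 1, a * p' t + b * q' t ≤ s t := fun t ht => by
    refine le_of_sq_le_sq ?_ (hs0 t ht)
    nlinarith [hle t ht, sq_nonneg (a * q' t - b * p' t)]
  have hpc : ContinuousOn (fun t => a * p' t + b * q' t) (Icc 0 1) :=
    (continuousOn_const.mul hp'c).add (continuousOn_const.mul hq'c)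
  refine ⟨?_, fun hmin => ?_⟩
  · rw [← hEint]
    exact intervalIntegral.integral_mono_on zero_le_one (hint hpc) (hint hs) hproj
  have hz := eqOn_zero_of_integral_nonpos (g := fun t => s t - (a * p' t + b * q' t))
    (hs.sub hpc) (fun t ht => sub_nonneg.2 (hproj t ht)) (by
      rw [intervalIntegral.integral_sub (hint hs) (hint hpc), hEint]; linarith)
  have hseq : ∀ t ∈ Icc (0 : ℝ) 1, s t = a * p' t + b * q' t := fun t ht =>
    sub_eq_zero.1 (hz t ht)
  have hperp : ∀ t ∈ Icc (0 : ℝ) 1, a * q' t - b * p' t = 0 := fun t ht => by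
    have h1 := hle t ht
    rw [hseq t ht] at h1
    have : (a * q' t - b * p' t) ^ 2 ≤ 0 := by nlinarith
    exact pow_eq_zero_iff two_ne_zero |>.1 (le_antisymm this (sq_nonneg _))
  have hdp := fun t (ht : t ∈ Icc (0 : ℝ) 1) => contDiffOn_hasDerivWithinAt hp ht
  have hdq := fun t (ht : t ∈ Icc (0 : ℝ) 1) => contDiffOn_hasDerivWithinAt hq ht
  have hline : ∀ t ∈ Icc (0 : ℝ) 1, a * q t - b * p t = a * q 0 - b * p 0 :=
    eq_of_hasDerivWithinAt_zero (g := fun t => a * q t - b * p t) fun t ht => by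
      have := ((hdq t ht).const_mul a).sub ((hdp t ht).const_mul b)
      exact this.congr_deriv (hperp t ht)
  -- the arc length along the segment
  set ψ : ℝ → ℝ := fun t => a * (p t - p 0) + b * (q t - q 0) with hψ
  have hψd : ∀ t ∈ Icc (0 : ℝ) 1, HasDerivWithinAt ψ (s t) (Icc 0 1) t := fun t ht => by
    have := (((hdp t ht).sub_const (p 0)).const_mul a).add
      (((hdq t ht).sub_const (q 0)).const_mul b)
    exact this.congr_deriv (hseq t ht).symm
  have hψc : ContinuousOn ψ (Icc 0 1) := fun t ht => (hψd t ht).continuousWithinAt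
  have hψm : MonotoneOn ψ (Icc 0 1) :=
    monotoneOn_of_hasDerivWithinAt_nonneg (convex_Icc 0 1) hψc
      (fun t ht => (hψd t (interior_subset ht)).mono interior_subset)
      fun t ht => hs0 t (interior_subset ht)
  have hψ0 : ψ 0 = 0 := by simp [hψ]
  have hψ1 : ψ 1 = E := by
    simp only [hψ]; linear_combination a * hu + b * hw + E * hab
  have hpψ : ∀ t ∈ Icc (0 : ℝ) 1, p t = p 0 + ψ t * a ∧ q t = q 0 + ψ t * b := fun t ht => by
    have h := hline t ht
    constructor
    · simp only [hψ]; linear_combination -(p t - p 0) * hab - b * h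
    · simp only [hψ]; linear_combination -(q t - q 0) * hab + a * h
  refine ⟨fun t ht => ?_, ?_⟩
  · have h1 := hperp t ht
    rw [hseq t ht]
    linear_combination (p' t ^ 2 + q' t ^ 2) * hab - (a * q' t - b * p' t) * h1
  have hψlin : (∃ c, ∀ t ∈ Icc (0 : ℝ) 1, s t = c) → ∀ t ∈ Icc (0 : ℝ) 1, ψ t = t * E := by
    rintro ⟨c, hc⟩
    have h := eq_of_hasDerivWithinAt_zero (g := fun t => ψ t - t * c) fun t ht => by
      have := (hψd t ht).sub ((hasDerivWithinAt_id t _).mul_const c)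
      exact this.congr_deriv (by rw [hc t ht]; ring)
    have h1 := h 1 (right_mem_Icc.2 zero_le_one)
    simp only [hψ0, hψ1] at h1
    intro t ht
    have h2 := h t ht
    simp only [hψ0] at h2
    linear_combination h2 - t * h1
  rcases eq_or_ne E 0 with hE0 | hE0
  · refine ⟨fun t => t, continuousOn_id, fun _ _ _ _ h => h, rfl, rfl, fun t ht => ?_,
      fun _ _ _ => rfl⟩
    have h1 : ψ t = 0 := le_antisymm
      (by simpa [hψ1, hE0] using hψm ht (right_mem_Icc.2 zero_le_one) ht.2)
      (by simpa [hψ0] using hψm (left_mem_Icc.2 zero_le_one) ht ht.1)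
    obtain ⟨h2, h3⟩ := hpψ t ht
    rw [hu, hw, hE0, h2, h3, h1]
    simp
  · have hEpos : 0 < E := lt_of_le_of_ne (Real.sqrt_nonneg _) (Ne.symm hE0)
    refine ⟨fun t => ψ t / E, hψc.div_const E,
      fun x hx y hy hxy => div_le_div_of_nonneg_right (hψm hx hy hxy) hEpos.le,
      by simp [hψ0], by simp [hψ1, hE0], fun t ht => ?_, fun hc t ht => ?_⟩
    · obtain ⟨h2, h3⟩ := hpψ t ht
      rw [hu, hw]
      constructor
      · rw [h2]; field_simp
      · rw [h3]; field_simp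
    · simp only [hψlin hc t ht]
      field_simp

/-! ### Planar development of a curve -/

/-- Bessel's inequality for the orthogonal vectors `(1, …, 1)` and `v`, with its error term. -/
theorem sum_sq_decomposition {m : ℕ} (hm : (m : ℝ) ≠ 0) (v y : Fin m → ℝ) (hv0 : ∑ i, v i = 0)
    (hv1 : ∑ i, v i ^ 2 ≤ 1) :
    (∑ i, y i) ^ 2 / m + (∑ i, v i * y i) ^ 2 +
      ∑ i, (y i - ((∑ j, y j) / m + (∑ j, v j * y j) * v i)) ^ 2 ≤ ∑ i, y i ^ 2 := by
  set L := ∑ i, y i with hL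
  set w := ∑ i, v i * y i with hw
  have h : ∑ i, (y i - (L / m + w * v i)) ^ 2 =
      ∑ i, y i ^ 2 + m * (L / m) ^ 2 + w ^ 2 * ∑ i, v i ^ 2 - 2 * (L / m) * L - 2 * w * w
        + 2 * (L / m) * w * ∑ i, v i := by
    have : ∀ i, (y i - (L / m + w * v i)) ^ 2 = y i ^ 2 + (L / m) ^ 2 + w ^ 2 * v i ^ 2
        - 2 * (L / m) * y i - 2 * w * (v i * y i) + 2 * (L / m) * w * v i := fun i => by ring
    simp only [this, Finset.sum_add_distrib, Finset.sum_sub_distrib, ← Finset.mul_sum, ← hL, ← hw]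
    simp
  rw [h, hv0]
  have h1 : (m : ℝ) * (L / m) ^ 2 = L ^ 2 / m := by field_simp
  have h2 : 2 * (L / m) * L = 2 * (L ^ 2 / m) := by ring
  rw [h1, h2]
  nlinarith [mul_le_mul_of_nonneg_left hv1 (sq_nonneg w)]

/-- The first Cartesian coordinate of the point of the plane with polar coordinates
`r = exp(β/2 ∑ xᵢ)`, the power `det^{β/2}` of the determinant at `diag(exp x)`, and
`θ = k ∑ vᵢ xᵢ`, the rescaled coordinate of `x` in the direction `v`. -/
noncomputable def planarX {m : ℕ} (β k : ℝ) (v x : Fin m → ℝ) : ℝ :=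
  Real.exp (β / 2 * ∑ i, x i) * Real.cos (k * ∑ i, v i * x i)

/-- The second Cartesian coordinate of the point described at `planarX`. -/
noncomputable def planarY {m : ℕ} (β k : ℝ) (v x : Fin m → ℝ) : ℝ :=
  Real.exp (β / 2 * ∑ i, x i) * Real.sin (k * ∑ i, v i * x i)

theorem contDiffOn_planarX {m : ℕ} (β k : ℝ) (v : Fin m → ℝ) {x : ℝ → Fin m → ℝ}
    (hx : ∀ i, ContDiffOn ℝ 1 (fun t => x t i) (Icc 0 1)) :
    ContDiffOn ℝ 1 (fun t => planarX β k v (x t)) (Icc 0 1) :=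
  (contDiffOn_const.mul (ContDiffOn.sum fun i _ => hx i)).exp.mul
    (contDiffOn_const.mul (ContDiffOn.sum fun i _ => contDiffOn_const.mul (hx i))).cos

theorem contDiffOn_planarY {m : ℕ} (β k : ℝ) (v : Fin m → ℝ) {x : ℝ → Fin m → ℝ}
    (hx : ∀ i, ContDiffOn ℝ 1 (fun t => x t i) (Icc 0 1)) :
    ContDiffOn ℝ 1 (fun t => planarY β k v (x t)) (Icc 0 1) :=
  (contDiffOn_const.mul (ContDiffOn.sum fun i _ => hx i)).exp.mul
    (contDiffOn_const.mul (ContDiffOn.sum fun i _ => contDiffOn_const.mul (hx i))).sin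

/-- The planar speed in polar form, `r'² + r² θ'²`. -/
theorem planar_speed_sq {m : ℕ} (β k : ℝ) (v : Fin m → ℝ) {x : ℝ → Fin m → ℝ} {x' : Fin m → ℝ}
    {t : ℝ} (ht : t ∈ Icc (0 : ℝ) 1)
    (hx : ∀ i, HasDerivWithinAt (fun t => x t i) (x' i) (Icc 0 1) t) :
    derivWithin (fun t => planarX β k v (x t)) (Icc 0 1) t ^ 2 +
      derivWithin (fun t => planarY β k v (x t)) (Icc 0 1) t ^ 2 =
    Real.exp (∑ i, x t i) ^ β *
      (β ^ 2 / 4 * (∑ i, x' i) ^ 2 + k ^ 2 * (∑ i, v i * x' i) ^ 2) := by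
  have hu := uniqueDiffOn_Icc zero_lt_one t ht
  have hr := (HasDerivWithinAt.const_mul (β / 2)
    (HasDerivWithinAt.fun_sum fun i (_ : i ∈ Finset.univ) => hx i)).exp
  have hθ := HasDerivWithinAt.const_mul k
    (HasDerivWithinAt.fun_sum fun i (_ : i ∈ Finset.univ) => (hx i).const_mul (v i))
  have h1 := (hr.mul hθ.cos).derivWithin hu
  have h2 := (hr.mul hθ.sin).derivWithin hu
  have e1 : derivWithin (fun t => planarX β k v (x t)) (Icc 0 1) t = _ := h1
  have e2 : derivWithin (fun t => planarY β k v (x t)) (Icc 0 1) t = _ := h2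
  have e3 : Real.exp (∑ i, x t i) ^ β = Real.exp (β / 2 * ∑ i, x t i) ^ 2 := by
    rw [← Real.exp_mul, sq, ← Real.exp_add]; congr 1; ring
  rw [e1, e2, e3]
  have := Real.sin_sq_add_cos_sq (k * ∑ i, v i * x t i)
  set r := Real.exp (β / 2 * ∑ i, x t i)
  set a := ∑ i, x' i
  set b := ∑ i, v i * x' i
  linear_combination (r ^ 2 * (β ^ 2 / 4 * a ^ 2 + k ^ 2 * b ^ 2)) * this

/-- Every curve starting at `1` and ending at `diag(exp f)` has a `C¹` family `x` of logarithmic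
coordinates whose planar development is not faster than `k` times the curve. If the two speeds
agree, then the curve is diagonal and moves in the directions `(1, …, 1)` and `v` only. The value of
`k` makes the metric on the plane spanned by these directions the flat one. -/
theorem IsCurve.exists_planar_development {m : ℕ} (hm : (m : ℝ) ≠ 0) {β k : ℝ} {v f : Fin m → ℝ}
    (hβ : β < 1 / m) (hk : k ^ 2 * (4 * (1 / m - β)) = β ^ 2) (hk0 : k ≠ 0)
    (hv0 : ∑ i, v i = 0) (hv1 : ∑ i, v i ^ 2 ≤ 1) {P : ℝ → Matrix (Fin m) (Fin m) ℝ}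
    (h : IsCurve 1 (diagonal fun i => Real.exp (f i)) P) :
    ∃ x : ℝ → Fin m → ℝ, (∀ i, ContDiffOn ℝ 1 (fun t => x t i) (Icc 0 1)) ∧ x 0 = 0 ∧ x 1 = f ∧
      (∀ t ∈ Icc (0 : ℝ) 1, derivWithin (fun t => planarX β k v (x t)) (Icc 0 1) t ^ 2 +
        derivWithin (fun t => planarY β k v (x t)) (Icc 0 1) t ^ 2 ≤ (k * speed β P t) ^ 2) ∧
      ((∀ t ∈ Icc (0 : ℝ) 1, (k * speed β P t) ^ 2 =
          derivWithin (fun t => planarX β k v (x t)) (Icc 0 1) t ^ 2 +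
          derivWithin (fun t => planarY β k v (x t)) (Icc 0 1) t ^ 2) →
        ∀ t ∈ Icc (0 : ℝ) 1, P t = diagonal (fun i => Real.exp (x t i)) ∧
          ∀ i, x t i = (∑ j, x t j) / m + (∑ j, v j * x t j) * v i) := by
  obtain ⟨U, x, hU, hx, hU1, hU0, hP, hPd⟩ := exists_contDiffOn_ldl (s := Icc 0 1) P h.posDef
    fun i j => (h.contDiffOn i j).of_le (by norm_num)
  have h0 : (0 : ℝ) ∈ Icc (0 : ℝ) 1 := left_mem_Icc.2 zero_le_one
  have h1 : (1 : ℝ) ∈ Icc (0 : ℝ) 1 := right_mem_Icc.2 zero_le_one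
  obtain ⟨hU00, hx0⟩ := hPd 0 h0 0 (by rw [h.source]; simp)
  obtain ⟨-, hx1⟩ := hPd 1 h1 f h.target
  set U' : ℝ → Matrix (Fin m) (Fin m) ℝ := velocity U with hU'
  set x' : ℝ → Fin m → ℝ := fun t i => derivWithin (fun t => x t i) (Icc 0 1) t with hx'
  have hUd : ∀ t ∈ Icc (0 : ℝ) 1, ∀ i j,
      HasDerivWithinAt (fun t => U t i j) (U' t i j) (Icc 0 1) t := fun t ht i j =>
    contDiffOn_hasDerivWithinAt (hU i j) ht
  have hxd : ∀ t ∈ Icc (0 : ℝ) 1, ∀ i,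
      HasDerivWithinAt (fun t => x t i) (x' t i) (Icc 0 1) t := fun t ht i =>
    contDiffOn_hasDerivWithinAt (hx i) ht
  have hU'0 : ∀ t i j, i ≤ j → U' t i j = 0 := fun t i j hij => by
    rcases hij.eq_or_lt with rfl | hij
    · simp [hU', velocity, hU1]
    · simp [hU', velocity, hU0 _ i j hij]
  have hPm : ∀ t ∈ Icc (0 : ℝ) 1, P t = U t * diagonal (fun i => Real.exp (x t i)) * (U t)ᵀ :=
    fun t ht => by
      ext i j
      rw [hP t ht, mul_apply]
      exact Finset.sum_congr rfl fun l _ => by rw [mul_diagonal, transpose_apply]; ring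
  have hV : ∀ t ∈ Icc (0 : ℝ) 1, velocity P t =
      U' t * diagonal (fun i => Real.exp (x t i)) * (U t)ᵀ +
      U t * diagonal (fun i => Real.exp (x t i) * x' t i) * (U t)ᵀ +
      U t * diagonal (fun i => Real.exp (x t i)) * (U' t)ᵀ := fun t ht => by
    refine velocity_eq ht fun i j => ?_
    have hd := HasDerivWithinAt.fun_sum fun l (_ : l ∈ Finset.univ) =>
      (((hxd t ht l).exp.mul (hUd t ht i l)).mul (hUd t ht j l))
    refine (hd.congr (fun s hs => hP s hs i j) (hP t ht i j)).congr_deriv ?_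
    simp only [Matrix.add_apply, mul_apply (M := _ * _), mul_diagonal, transpose_apply,
      ← Finset.sum_add_distrib]
    exact Finset.sum_congr rfl fun l _ => by simp only [Pi.mul_apply]; ring
  have hldl := fun t (ht : t ∈ Icc (0 : ℝ) 1) => ldl_velocity (x t) (x' t) (U t) (U' t) (P t)
    (velocity P t) (hU1 t) (hU0 t) (hU'0 t) (hPm t ht) (hV t ht)
  have hgap : 0 < 1 / (m : ℝ) - β := sub_pos.2 hβ
  -- the square of the speed dominates that of the planar development, with explicit error terms
  have hmain : ∀ t ∈ Icc (0 : ℝ) 1,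
      derivWithin (fun t => planarX β k v (x t)) (Icc 0 1) t ^ 2 +
        derivWithin (fun t => planarY β k v (x t)) (Icc 0 1) t ^ 2 +
      k ^ 2 * (P t).det ^ β *
        ((((P t)⁻¹ * velocity P t * (P t)⁻¹ * velocity P t).trace - ∑ i, x' t i ^ 2) +
        ∑ i, (x' t i - ((∑ j, x' t j) / m + (∑ j, v j * x' t j) * v i)) ^ 2)
        ≤ (k * speed β P t) ^ 2 := fun t ht => by
    obtain ⟨hdet, htr, hle, -⟩ := hldl t ht
    have hdec := sum_sq_decomposition hm v (x' t) hv0 hv1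
    have hnn := Finset.sum_nonneg fun i (_ : i ∈ Finset.univ) =>
      sq_nonneg (x' t i - ((∑ j, x' t j) / m + (∑ j, v j * x' t j) * v i))
    have hpos : 0 < (P t).det ^ β := Real.rpow_pos_of_pos (h.posDef t ht).det_pos _
    have hmet : metric β (P t) (velocity P t) (velocity P t) = (P t).det ^ β *
        (((P t)⁻¹ * velocity P t * (P t)⁻¹ * velocity P t).trace - β * (∑ i, x' t i) ^ 2) := by
      rw [metric, htr]; ring
    rw [planar_speed_sq β k v ht (hxd t ht), ← hdet]
    set τ := ((P t)⁻¹ * velocity P t * (P t)⁻¹ * velocity P t).trace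
    set L := ∑ i, x' t i
    set w := ∑ j, v j * x' t j
    set R := ∑ i, (x' t i - (L / m + w * v i)) ^ 2
    have hbr : (1 / (m : ℝ) - β) * L ^ 2 + w ^ 2 + (τ - ∑ i, x' t i ^ 2 + R) ≤ τ - β * L ^ 2 := by
      have : (1 / (m : ℝ) - β) * L ^ 2 = L ^ 2 / m - β * L ^ 2 := by ring
      linarith
    have hmet0 : 0 ≤ metric β (P t) (velocity P t) (velocity P t) := by
      rw [hmet]
      refine mul_nonneg hpos.le (le_trans ?_ hbr)
      have := mul_nonneg hgap.le (sq_nonneg L)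
      nlinarith [sq_nonneg w]
    rw [mul_pow, speed, Real.sq_sqrt hmet0, hmet]
    calc _ = k ^ 2 * (P t).det ^ β *
          ((1 / (m : ℝ) - β) * L ^ 2 + w ^ 2 + (τ - ∑ i, x' t i ^ 2 + R)) := by
          linear_combination -(P t).det ^ β * L ^ 2 / 4 * hk
      _ ≤ k ^ 2 * (P t).det ^ β * (τ - β * L ^ 2) := by gcongr
      _ = _ := by ring
  have hnn : ∀ t, 0 ≤ ∑ i, (x' t i - ((∑ j, x' t j) / m + (∑ j, v j * x' t j) * v i)) ^ 2 :=
    fun t => Finset.sum_nonneg fun i _ => sq_nonneg _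
  refine ⟨x, hx, hx0, hx1, fun t ht => ?_, fun heq => ?_⟩
  · obtain ⟨-, -, hle, -⟩ := hldl t ht
    have hpos : 0 < (P t).det ^ β := Real.rpow_pos_of_pos (h.posDef t ht).det_pos _
    refine le_trans (le_add_of_nonneg_right ?_) (hmain t ht)
    exact mul_nonneg (by positivity) (add_nonneg (sub_nonneg.2 hle) (hnn t))
  have hzero : ∀ t ∈ Icc (0 : ℝ) 1, U' t = 0 ∧
      ∀ i, x' t i = (∑ j, x' t j) / m + (∑ j, v j * x' t j) * v i := fun t ht => by
    obtain ⟨-, -, hle, hcase⟩ := hldl t ht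
    have hpos : 0 < (P t).det ^ β := Real.rpow_pos_of_pos (h.posDef t ht).det_pos _
    have h2 := hmain t ht
    rw [heq t ht] at h2
    have h3 := nonpos_of_mul_nonpos_right ((add_le_iff_nonpos_right _).1 h2)
      (by positivity)
    have h4 := hnn t
    refine ⟨hcase (by linarith), fun i => ?_⟩
    have h5 := (Finset.sum_eq_zero_iff_of_nonneg fun i _ => sq_nonneg _).1
      (le_antisymm (by linarith) h4) i (Finset.mem_univ i)
    exact sub_eq_zero.1 (pow_eq_zero_iff two_ne_zero |>.1 h5)
  -- the triangular factor is constant, and equal to `1` at the starting point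
  have hUt : ∀ t ∈ Icc (0 : ℝ) 1, U t = 1 := fun t ht => by
    rw [← hU00]
    ext i j
    exact eq_of_hasDerivWithinAt_zero (g := fun t => U t i j)
      (fun s hs => (hUd s hs i j).congr_deriv (by rw [(hzero s hs).1]; rfl)) t ht
  intro t ht
  refine ⟨by rw [hPm t ht, hUt t ht]; simp, fun i => ?_⟩
  have := eq_of_hasDerivWithinAt_zero
    (g := fun t => x t i - ((∑ j, x t j) / m + (∑ j, v j * x t j) * v i)) (fun s hs => by
      have hd := (hxd s hs i).sub
        (((HasDerivWithinAt.fun_sum fun j (_ : j ∈ Finset.univ) => hxd s hs j).div_const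
          (m : ℝ)).add
        ((HasDerivWithinAt.fun_sum fun j (_ : j ∈ Finset.univ) =>
          (hxd s hs j).const_mul (v j)).mul_const (v i)))
      exact hd.congr_deriv (sub_eq_zero.2 ((hzero s hs).2 i))) t ht
  simp only [hx0, Pi.zero_apply, Finset.sum_const_zero, mul_zero, zero_div, zero_mul, sub_zero,
    add_zero] at this
  exact sub_eq_zero.1 this

/-! ### The unique geodesic between `1` and a diagonal matrix -/

theorem IsCurve.continuousOn_speed {m : ℕ} {A B : Matrix (Fin m) (Fin m) ℝ} (β : ℝ)
    {P : ℝ → Matrix (Fin m) (Fin m) ℝ} (h : IsCurve A B P) :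
    ContinuousOn (speed β P) (Icc 0 1) := by
  have hP : ContinuousOn P (Icc 0 1) :=
    continuousOn_pi.2 fun i => continuousOn_pi.2 fun j => (h.contDiffOn i j).continuousOn
  have hV : ContinuousOn (velocity P) (Icc 0 1) :=
    continuousOn_pi.2 fun i => continuousOn_pi.2 fun j =>
      (h.contDiffOn i j).continuousOn_derivWithin (uniqueDiffOn_Icc zero_lt_one) (by norm_num)
  have hdet : ContinuousOn (fun t => (P t).det) (Icc 0 1) :=
    (Continuous.matrix_det continuous_id).comp_continuousOn hP
  have hdet0 : ∀ t ∈ Icc (0 : ℝ) 1, (P t).det ≠ 0 := fun t ht => (h.posDef t ht).det_pos.ne'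
  have hinv : ContinuousOn (fun t => (P t)⁻¹) (Icc 0 1) := by
    simp only [inv_def, Ring.inverse_eq_inv']
    exact (hdet.inv₀ hdet0).smul ((Continuous.matrix_adjugate continuous_id).comp_continuousOn hP)
  have htr : ∀ {F : ℝ → Matrix (Fin m) (Fin m) ℝ}, ContinuousOn F (Icc 0 1) →
      ContinuousOn (fun t => (F t).trace) (Icc 0 1) := fun hF =>
    (Continuous.matrix_trace continuous_id).comp_continuousOn hF
  unfold speed metric
  refine ContinuousOn.sqrt (ContinuousOn.mul (hdet.rpow_const fun t ht => Or.inl (hdet0 t ht)) ?_)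
  have h1 := hinv.mul hV
  exact (htr ((h1.mul hinv).mul hV)).sub ((continuousOn_const.mul (htr h1)).mul (htr h1))

/-- The vector in the span of `(1, …, 1)` and `v` with planar coordinates `(p, q)`, for `p > 0`; it is
the inverse of `planarX`, `planarY` over the right half-plane, see `logCoord_planar`. -/
noncomputable def logCoord {m : ℕ} (β k : ℝ) (v : Fin m → ℝ) (p q : ℝ) (i : Fin m) : ℝ :=
  1 / (m * β) * Real.log (p ^ 2 + q ^ 2) + Real.arctan (q / p) / k * v i

theorem logCoord_planar {m : ℕ} {β k : ℝ} (hβ : β ≠ 0) (hk0 : k ≠ 0) (v x : Fin m → ℝ)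
    (hx : ∀ i, x i = (∑ j, x j) / m + (∑ j, v j * x j) * v i)
    (hθ1 : -(Real.pi / 2) < k * ∑ j, v j * x j) (hθ2 : k * ∑ j, v j * x j < Real.pi / 2) (i : Fin m) :
    logCoord β k v (planarX β k v x) (planarY β k v x) i = x i := by
  have h1 : planarX β k v x ^ 2 + planarY β k v x ^ 2 = Real.exp (β * ∑ i, x i) := by
    have : Real.exp (β * ∑ i, x i) = Real.exp (β / 2 * ∑ i, x i) ^ 2 := by
      rw [sq, ← Real.exp_add]; congr 1; ring
    rw [this, planarX, planarY]
    linear_combination Real.exp (β / 2 * ∑ i, x i) ^ 2 *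
      Real.sin_sq_add_cos_sq (k * ∑ i, v i * x i)
  have h2 : planarY β k v x / planarX β k v x = Real.tan (k * ∑ i, v i * x i) := by
    rw [planarX, planarY, mul_div_mul_left _ _ (Real.exp_pos _).ne', Real.tan_eq_sin_div_cos]
  rw [logCoord, h1, h2, Real.log_exp, Real.arctan_tan hθ1 hθ2, hx i]
  field_simp

/-- A continuous angle that starts at `0` and keeps a positive cosine stays in `(-π/2, π/2)`. -/
theorem abs_lt_pi_div_two_of_cos_pos {g : ℝ → ℝ} (hg : ContinuousOn g (Icc 0 1)) (h0 : g 0 = 0)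
    (hcos : ∀ t ∈ Icc (0 : ℝ) 1, 0 < Real.cos (g t)) {t : ℝ} (ht : t ∈ Icc (0 : ℝ) 1) :
    -(Real.pi / 2) < g t ∧ g t < Real.pi / 2 := by
  have hsub : Icc 0 t ⊆ Icc (0 : ℝ) 1 := Icc_subset_Icc_right ht.2
  constructor
  · by_contra! hle
    obtain ⟨s, hs, he⟩ := intermediate_value_Icc' ht.1 (hg.mono hsub)
      (show -(Real.pi / 2) ∈ Icc (g t) (g 0) from ⟨hle, by rw [h0]; linarith [Real.pi_pos]⟩)
    have := hcos s (hsub hs)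
    rw [he, Real.cos_neg, Real.cos_pi_div_two] at this
    exact lt_irrefl _ this
  · by_contra! hle
    obtain ⟨s, hs, he⟩ := intermediate_value_Icc ht.1 (hg.mono hsub)
      (show Real.pi / 2 ∈ Icc (g 0) (g t) from ⟨by rw [h0]; linarith [Real.pi_pos], hle⟩)
    have := hcos s (hsub hs)
    rw [he, Real.cos_pi_div_two] at this
    exact lt_irrefl _ this

/-- The diagonal curve whose planar development is the segment from `(1, 0)` to `(p₁, q₁)`,
run through with constant speed, for `p₁ > 0`. -/
noncomputable def segmentCurve {m : ℕ} (β k : ℝ) (v : Fin m → ℝ) (p₁ q₁ t : ℝ) :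
    Matrix (Fin m) (Fin m) ℝ :=
  diagonal fun i => Real.exp (logCoord β k v (1 + t * (p₁ - 1)) (t * q₁) i)

theorem metric_diagonal {m : ℕ} (β : ℝ) (x x' : Fin m → ℝ) :
    metric β (diagonal fun i => Real.exp (x i)) (diagonal fun i => Real.exp (x i) * x' i)
      (diagonal fun i => Real.exp (x i) * x' i) =
    Real.exp (∑ i, x i) ^ β * (∑ i, x' i ^ 2 - β * (∑ i, x' i) ^ 2) := by
  have hinv : (diagonal fun i => Real.exp (x i))⁻¹ = diagonal fun i => Real.exp (-x i) := by
    apply inv_eq_left_inv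
    rw [diagonal_mul_diagonal]
    simp [← Real.exp_add]
  have h : ∀ i, Real.exp (-x i) * (Real.exp (x i) * x' i) = x' i := fun i => by
    rw [← mul_assoc, ← Real.exp_add]; simp
  rw [metric, hinv, det_diagonal, ← Real.exp_sum]
  simp only [diagonal_mul_diagonal, h, trace_diagonal, mul_assoc]
  simp only [sq]

section Segment

variable {m : ℕ} {β k p₁ q₁ : ℝ} {v : Fin m → ℝ}

theorem segment_pos (hp : 0 < p₁) {t : ℝ} (ht : t ∈ Icc (0 : ℝ) 1) : 0 < 1 + t * (p₁ - 1) := by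
  rcases ht.1.eq_or_lt with rfl | h0
  · simp
  · nlinarith [ht.2, mul_pos h0 hp]

theorem isCurve_segmentCurve (hp : 0 < p₁) {f : Fin m → ℝ}
    (hf : ∀ i, logCoord β k v p₁ q₁ i = f i) :
    IsCurve 1 (diagonal fun i => Real.exp (f i)) (segmentCurve β k v p₁ q₁) where
  posDef t _ := PosDef.diagonal fun i => Real.exp_pos _
  contDiffOn i j := by
    have h1 : ContDiffOn ℝ 2 (fun t : ℝ => 1 + t * (p₁ - 1)) (Icc 0 1) := by fun_prop
    have h2 : ContDiffOn ℝ 2 (fun t : ℝ => t * q₁) (Icc 0 1) := by fun_prop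
    rcases eq_or_ne i j with rfl | hij
    · simp only [segmentCurve, diagonal_apply_eq, logCoord]
      refine ContDiffOn.exp ((contDiffOn_const.mul (ContDiffOn.log ((h1.pow 2).add (h2.pow 2))
        fun t ht => ?_)).add ((((h2.div h1 fun t ht => (segment_pos hp ht).ne').arctan).div_const
          k).mul contDiffOn_const))
      have := segment_pos hp ht
      positivity
    · simp only [segmentCurve, diagonal_apply_ne _ hij]
      exact contDiffOn_const
  source := by simp [segmentCurve, logCoord]
  target := by simp [segmentCurve, hf]

/-- The norm of `v` only matters if the segment is not radial. -/
theorem speed_segmentCurve (hm : (m : ℝ) ≠ 0) (hβ : β ≠ 0)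
    (hk : k ^ 2 * (4 * (1 / m - β)) = β ^ 2) (hk0 : 0 < k) (hv0 : ∑ i, v i = 0)
    (hv1 : q₁ = 0 ∨ ∑ i, v i ^ 2 = 1) (hp : 0 < p₁) {t : ℝ} (ht : t ∈ Icc (0 : ℝ) 1) :
    k * speed β (segmentCurve β k v p₁ q₁) t = √((p₁ - 1) ^ 2 + q₁ ^ 2) := by
  set p := 1 + t * (p₁ - 1) with hpdef
  set q := t * q₁ with hqdef
  have hppos : 0 < p := segment_pos hp ht
  have hr : 0 < p ^ 2 + q ^ 2 := by positivity
  set L' := 1 / β * ((2 * p * (p₁ - 1) + 2 * q * q₁) / (p ^ 2 + q ^ 2)) with hL'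
  set θ' := (p * q₁ - q * (p₁ - 1)) / (p ^ 2 + q ^ 2) with hθ'
  have hdp : HasDerivAt (fun t : ℝ => 1 + t * (p₁ - 1)) (p₁ - 1) t := by
    simpa using ((hasDerivAt_id t).mul_const (p₁ - 1)).const_add 1
  have hdq : HasDerivAt (fun t : ℝ => t * q₁) q₁ t := by
    simpa using (hasDerivAt_id t).mul_const q₁
  have hdlog := (((hdp.pow 2).add (hdq.pow 2)).log (show p ^ 2 + q ^ 2 ≠ 0 from hr.ne')).const_mul
    (1 / (m * β))
  have hdarc := ((hdq.div hdp hppos.ne').arctan.div_const k)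
  have hd : ∀ i, HasDerivAt (fun t => logCoord β k v (1 + t * (p₁ - 1)) (t * q₁) i)
      (L' / m + θ' / k * v i) t := fun i => by
    refine (hdlog.add (hdarc.mul_const (v i))).congr_deriv ?_
    simp only [Pi.add_apply, Pi.pow_apply, Pi.div_apply, ← hpdef, ← hqdef]
    have : 1 + (q / p) ^ 2 ≠ 0 := by positivity
    rw [hL', hθ']
    field_simp
    ring
  have hvel : velocity (segmentCurve β k v p₁ q₁) t =
      diagonal fun i => Real.exp (logCoord β k v p q i) * (L' / m + θ' / k * v i) := by
    refine velocity_eq ht fun i j => ?_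
    rcases eq_or_ne i j with rfl | hij
    · simp only [segmentCurve, diagonal_apply_eq]
      exact (hd i).exp.hasDerivWithinAt
    · simp only [segmentCurve, diagonal_apply_ne _ hij]
      exact hasDerivWithinAt_const _ _ _
  have hsum : ∑ i, logCoord β k v p q i = 1 / β * Real.log (p ^ 2 + q ^ 2) := by
    simp only [logCoord, Finset.sum_add_distrib, ← Finset.mul_sum, hv0, Finset.sum_const,
      Finset.card_univ, Fintype.card_fin, nsmul_eq_mul]
    field_simp
    simp
  have hexp : Real.exp (∑ i, logCoord β k v p q i) ^ β = p ^ 2 + q ^ 2 := by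
    rw [hsum, ← Real.exp_mul, mul_right_comm, one_div_mul_cancel hβ, one_mul, Real.exp_log hr]
  have hs1 : ∑ i, (L' / m + θ' / k * v i) = L' := by
    simp only [Finset.sum_add_distrib, ← Finset.mul_sum, hv0, Finset.sum_const,
      Finset.card_univ, Fintype.card_fin, nsmul_eq_mul]
    field_simp
    simp
  -- for a radial segment the angle is constant, so the norm of `v` does not matter
  have hθv : θ' ^ 2 * ∑ i, v i ^ 2 = θ' ^ 2 := by
    rcases hv1 with h | h
    · have : θ' = 0 := by rw [hθ', hqdef, h]; simp
      simp [this]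
    · rw [h, mul_one]
  have hs2 : k ^ 2 * ∑ i, (L' / m + θ' / k * v i) ^ 2 = k ^ 2 * (L' ^ 2 / m) + θ' ^ 2 := by
    have : ∀ i, (L' / m + θ' / k * v i) ^ 2 =
        (L' / m) ^ 2 + 2 * (L' / m) * (θ' / k) * v i + (θ' / k) ^ 2 * v i ^ 2 := fun i => by ring
    simp only [this, Finset.sum_add_distrib, ← Finset.mul_sum, hv0, Finset.sum_const,
      Finset.card_univ, Fintype.card_fin, nsmul_eq_mul]
    rw [← hθv]
    field_simp
    ring
  have hsq : ∀ z, k * √z = √(k ^ 2 * z) := fun z => by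
    rw [Real.sqrt_mul (sq_nonneg k), Real.sqrt_sq hk0.le]
  rw [speed, hvel, segmentCurve, metric_diagonal, hexp, hs1, hsq]
  congr 1
  have e : k ^ 2 * ((p ^ 2 + q ^ 2) * (∑ i, (L' / m + θ' / k * v i) ^ 2 - β * L' ^ 2)) =
      (p ^ 2 + q ^ 2) * (β ^ 2 / 4 * L' ^ 2 + θ' ^ 2) := by
    linear_combination (p ^ 2 + q ^ 2) * hs2 + (p ^ 2 + q ^ 2) * L' ^ 2 / 4 * hk
  rw [e, hL', hθ']
  field_simp
  ring

/-- The bounds on the angle of the endpoint keep the segment in the right half-plane, where planar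
coordinates determine the diagonal matrix. -/
theorem isUniqueGeodesic_segmentCurve (hm : (m : ℝ) ≠ 0) (hβ : β ≠ 0) (hβm : β < 1 / m)
    (hk : k ^ 2 * (4 * (1 / m - β)) = β ^ 2) (hk0 : 0 < k) (hv0 : ∑ i, v i = 0) {f : Fin m → ℝ}
    (hv1 : ∑ i, v i ^ 2 = 1 ∨ ∑ i, v i * f i = 0) (hvle : ∑ i, v i ^ 2 ≤ 1)
    (hf : ∀ i, f i = (∑ j, f j) / m + (∑ j, v j * f j) * v i)
    (hθ1 : -(Real.pi / 2) < k * ∑ j, v j * f j) (hθ2 : k * ∑ j, v j * f j < Real.pi / 2) :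
    IsUniqueGeodesic β 1 (diagonal fun i => Real.exp (f i))
      (segmentCurve β k v (planarX β k v f) (planarY β k v f)) := by
  have hp : 0 < planarX β k v f :=
    mul_pos (Real.exp_pos _) (Real.cos_pos_of_mem_Ioo ⟨hθ1, hθ2⟩)
  set p₁ := planarX β k v f with hp₁
  set q₁ := planarY β k v f with hq₁
  have hq : q₁ = 0 ∨ ∑ i, v i ^ 2 = 1 := by
    rcases hv1 with h | h
    · exact Or.inr h
    · left; simp [hq₁, planarY, h]
  have hG : IsCurve 1 (diagonal fun i => Real.exp (f i)) (segmentCurve β k v p₁ q₁) :=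
    isCurve_segmentCurve hp fun i => logCoord_planar hβ hk0.ne' v f hf hθ1 hθ2 i
  have hGs : ∀ t ∈ Icc (0 : ℝ) 1, k * speed β (segmentCurve β k v p₁ q₁) t =
      √((p₁ - 1) ^ 2 + q₁ ^ 2) := fun t ht =>
    speed_segmentCurve hm hβ hk hk0 hv0 hq hp ht
  have hlen : ∀ Q : ℝ → Matrix (Fin m) (Fin m) ℝ,
      k * length β Q = ∫ t in (0 : ℝ)..1, k * speed β Q t := fun Q => by
    rw [length, intervalIntegral.integral_const_mul]
  have hGl : k * length β (segmentCurve β k v p₁ q₁) = √((p₁ - 1) ^ 2 + q₁ ^ 2) := by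
    rw [hlen, intervalIntegral.integral_congr (g := fun _ => √((p₁ - 1) ^ 2 + q₁ ^ 2))
      fun t ht => hGs t (by rwa [uIcc_of_le zero_le_one] at ht)]
    simp
  have h0 : (0 : ℝ) ∈ Icc (0 : ℝ) 1 := left_mem_Icc.2 zero_le_one
  -- compare an arbitrary curve with the segment through its planar development
  have key : ∀ Q, IsCurve 1 (diagonal fun i => Real.exp (f i)) Q →
      k * length β (segmentCurve β k v p₁ q₁) ≤ k * length β Q ∧
      (k * length β Q ≤ k * length β (segmentCurve β k v p₁ q₁) →
        ∃ φ : ℝ → ℝ, ContinuousOn φ (Icc 0 1) ∧ MonotoneOn φ (Icc 0 1) ∧ φ 0 = 0 ∧ φ 1 = 1 ∧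
          (∀ t ∈ Icc (0 : ℝ) 1, Q t = segmentCurve β k v p₁ q₁ (φ t)) ∧
          ((∃ c, ∀ t ∈ Icc (0 : ℝ) 1, speed β Q t = c) → ∀ t ∈ Icc (0 : ℝ) 1, φ t = t)) := by
    intro Q hQ
    obtain ⟨x, hx, hx0, hx1, hle, heq⟩ :=
      hQ.exists_planar_development hm hβm hk hk0.ne' hv0 hvle
    have hX0 : planarX β k v (x 0) = 1 := by simp [hx0, planarX]
    have hY0 : planarY β k v (x 0) = 0 := by simp [hx0, planarY]
    obtain ⟨h1, h2⟩ := planar_length (contDiffOn_planarX β k v hx) (contDiffOn_planarY β k v hx)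
      (s := fun t => k * speed β Q t) (continuousOn_const.mul (hQ.continuousOn_speed β))
      (fun t _ => mul_nonneg hk0.le (Real.sqrt_nonneg _)) hle
    simp only [hX0, hY0, hx1, ← hp₁, ← hq₁, sub_zero, zero_add, ← hlen] at h1 h2
    rw [hGl]
    refine ⟨h1, fun hmin => ?_⟩
    obtain ⟨h3, φ, hφc, hφm, hφ0, hφ1, hφ, hφt⟩ := h2 hmin
    have h4 := heq h3
    refine ⟨φ, hφc, hφm, hφ0, hφ1, fun t ht => ?_, fun ⟨c, hc⟩ =>
      hφt ⟨k * c, fun t ht => by rw [hc t ht]⟩⟩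
    have hmem : ∀ s ∈ Icc (0 : ℝ) 1, φ s ∈ Icc (0 : ℝ) 1 := fun s hs =>
      ⟨hφ0 ▸ hφm h0 hs hs.1, hφ1 ▸ hφm hs (right_mem_Icc.2 zero_le_one) hs.2⟩
    -- the segment stays in the right half-plane, so the continuous angle equals the arctangent
    have hcos : ∀ s ∈ Icc (0 : ℝ) 1, 0 < Real.cos (k * ∑ i, v i * x s i) := fun s hs => by
      have h5 : 0 < planarX β k v (x s) := by
        rw [(hφ s hs).1]; exact segment_pos hp (hmem s hs)
      exact pos_of_mul_pos_right h5 (Real.exp_pos _).le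
    obtain ⟨h5, h6⟩ := abs_lt_pi_div_two_of_cos_pos (g := fun s => k * ∑ i, v i * x s i)
      (continuousOn_const.mul (continuousOn_finsetSum _ fun i _ =>
        continuousOn_const.mul (hx i).continuousOn)) (by simp [hx0]) hcos ht
    rw [(h4 t ht).1, segmentCurve]
    congr 1
    funext i
    rw [← logCoord_planar hβ hk0.ne' v (x t) (h4 t ht).2 h5 h6 i, (hφ t ht).1, (hφ t ht).2]
  refine ⟨⟨⟨hG, fun Q hQ => le_of_mul_le_mul_left (key Q hQ).1 hk0⟩,
    √((p₁ - 1) ^ 2 + q₁ ^ 2) / k, fun t ht => by rw [eq_div_iff hk0.ne', mul_comm, hGs t ht]⟩,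
    fun P hP t ht => ?_, fun P hP => ?_⟩
  · obtain ⟨φ, -, -, -, -, h5, h6⟩ := (key P hP.1.1).2
      (mul_le_mul_of_nonneg_left (hP.1.2 _ hG) hk0.le)
    rw [h5 t ht, h6 hP.2 t ht]
  · obtain ⟨φ, h1, h2, h3, h4, h5, -⟩ := (key P hP.1).2
      (mul_le_mul_of_nonneg_left (hP.2 _ hG) hk0.le)
    exact ⟨φ, h1, h2, h3, h4, h5⟩

end Segment

/-! ### Simultaneous diagonalization and the parameters of the formula -/

theorem exists_orthogonal_diagonalization {m : ℕ} {A : Matrix (Fin m) (Fin m) ℝ} (hA : A.PosDef) :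
    ∃ (M : Matrix (Fin m) (Fin m) ℝ) (a : Fin m → ℝ), IsPosDiagonalization A M a ∧ M⁻¹ = Mᵀ := by
  set V : Matrix (Fin m) (Fin m) ℝ := ↑hA.isHermitian.eigenvectorUnitary with hV
  have h1 : star V * V = 1 := Unitary.coe_star_mul_self hA.isHermitian.eigenvectorUnitary
  have ht : star V = Vᵀ := by rw [star_eq_conjTranspose, conjTranspose_eq_transpose_of_trivial]
  rw [ht] at h1
  have h2 : V * Vᵀ = 1 := mul_eq_one_comm.1 h1
  have hinv : Vᵀ⁻¹ = V := inv_eq_left_inv h2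
  refine ⟨Vᵀ, hA.isHermitian.eigenvalues, ⟨?_, hA.eigenvalues_pos, ?_⟩, ?_⟩
  · exact (isUnit_iff_isUnit_det _).2 (isUnit_det_of_left_inverse h2)
  · rw [hinv]
    have := hA.isHermitian.spectral_theorem
    rw [Unitary.conjStarAlgAut_apply] at this
    conv_lhs => rw [this]
    rw [← hV, ← ht]
    rfl
  · rw [hinv, transpose_transpose]

theorem exists_simultaneous_diagonalization {m : ℕ} {A B : Matrix (Fin m) (Fin m) ℝ}
    (hA : A.PosDef) (hB : B.PosDef) :
    ∃ (C : Matrix (Fin m) (Fin m) ℝ) (f : Fin m → ℝ), IsUnit C ∧ A = C * Cᵀ ∧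
      B = C * diagonal (fun i => Real.exp (f i)) * Cᵀ := by
  obtain ⟨M, a, ⟨hM, ha, hAM⟩, hMt⟩ := exists_orthogonal_diagonalization hA
  set R := Mᵀ * diagonal fun i => √(a i) with hR
  have hRR : A = R * Rᵀ := by
    have hs : diagonal a = diagonal (fun i => √(a i)) * diagonal fun i => √(a i) := by
      rw [diagonal_mul_diagonal]
      simp only [Real.mul_self_sqrt (ha _).le]
    rw [hAM, hR, hMt, hs, transpose_mul, transpose_transpose, diagonal_transpose]
    simp only [Matrix.mul_assoc]
  have hRu : IsUnit R := by
    rw [isUnit_iff_isUnit_det]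
    have := hA.det_pos
    rw [hRR, det_mul] at this
    exact isUnit_iff_ne_zero.2 fun h => by simp [h] at this
  have hRi : IsUnit R⁻¹ := isUnit_nonsing_inv_iff.2 hRu
  have hB' : (R⁻¹ * B * R⁻¹ᵀ).PosDef := by
    have := (IsUnit.posDef_star_right_conjugate_iff hRi).2 hB
    rwa [star_eq_conjTranspose, conjTranspose_eq_transpose_of_trivial] at this
  obtain ⟨N, b, ⟨hN, hb, hBN⟩, hNt⟩ := exists_orthogonal_diagonalization hB'
  have hNN : Nᵀ * N = 1 := by
    rw [← hNt, nonsing_inv_mul _ ((isUnit_iff_isUnit_det N).1 hN)]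
  refine ⟨R * Nᵀ, fun i => Real.log (b i), hRu.mul ?_, ?_, ?_⟩
  · rw [← hNt]; exact isUnit_nonsing_inv_iff.2 hN
  · rw [transpose_mul, transpose_transpose, Matrix.mul_assoc, ← Matrix.mul_assoc Nᵀ, hNN,
      Matrix.one_mul, hRR]
  · simp only [Real.exp_log (hb _)]
    rw [transpose_mul, transpose_transpose, ← conj_inv_conj hRu B, hBN, hNt]
    simp only [Matrix.mul_assoc]

section Parameters

variable {m : ℕ} {C : Matrix (Fin m) (Fin m) ℝ} {f : Fin m → ℝ}

theorem inv_mul_congr_diagonal (hC : IsUnit C) (D : Matrix (Fin m) (Fin m) ℝ) :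
    (C * Cᵀ)⁻¹ * (C * D * Cᵀ) = Cᵀ⁻¹ * D * Cᵀ := by
  have h := (isUnit_iff_isUnit_det C).1 hC
  rw [Matrix.mul_inv_rev]
  calc Cᵀ⁻¹ * C⁻¹ * (C * D * Cᵀ) = Cᵀ⁻¹ * (C⁻¹ * C) * D * Cᵀ := by simp only [Matrix.mul_assoc]
    _ = _ := by rw [nonsing_inv_mul _ h, Matrix.mul_one]

theorem isPosDiagonalization_inv_mul (hC : IsUnit C) :
    IsPosDiagonalization ((C * Cᵀ)⁻¹ * (C * diagonal (fun i => Real.exp (f i)) * Cᵀ)) Cᵀ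
      (fun i => Real.exp (f i)) :=
  ⟨(isUnit_transpose C).2 hC, fun _ => Real.exp_pos _, inv_mul_congr_diagonal hC _⟩

theorem sigma_eq (hC : IsUnit C) (β : ℝ) :
    sigma β (C * Cᵀ) (C * diagonal (fun i => Real.exp (f i)) * Cᵀ) =
      Real.exp (β / 2 * ∑ i, f i) := by
  have h : IsUnit Cᵀ := (isUnit_transpose C).2 hC
  rw [sigma, inv_mul_congr_diagonal hC, det_conj' h, det_diagonal, ← Real.exp_sum, ← Real.exp_mul,
    mul_comm]

theorem dist₁_eq (hC : IsUnit C) :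
    dist₁ (C * Cᵀ) (C * diagonal (fun i => Real.exp (f i)) * Cᵀ) =
      √(∑ i, (f i - (∑ j, f j) / m) ^ 2) := by
  have hCd : C.det ≠ 0 := isUnit_iff_ne_zero.1 ((isUnit_iff_isUnit_det C).1 hC)
  have hCt : IsUnit Cᵀ := (isUnit_transpose C).2 hC
  have hA : 0 < (C * Cᵀ).det := by
    rw [det_mul, det_transpose]; exact mul_self_pos.2 hCd
  have hB : (C * diagonal (fun i => Real.exp (f i)) * Cᵀ).det =
      Real.exp (∑ i, f i) * (C * Cᵀ).det := by
    rw [det_mul, det_mul, det_diagonal, ← Real.exp_sum, det_mul]; ring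
  have hAp : 0 < (C * Cᵀ).det ^ (-(1 / (m : ℝ))) := Real.rpow_pos_of_pos hA _
  have hscal : ((C * Cᵀ).det ^ (-(1 / (m : ℝ))))⁻¹ *
      (C * diagonal (fun i => Real.exp (f i)) * Cᵀ).det ^ (-(1 / (m : ℝ))) =
      Real.exp (-((∑ i, f i) / m)) := by
    rw [hB, Real.mul_rpow (Real.exp_pos _).le hA.le, mul_comm, mul_assoc, mul_inv_cancel₀ hAp.ne',
      mul_one, ← Real.exp_mul]
    congr 1; ring
  have hmat : ((C * Cᵀ).det ^ (-(1 / (m : ℝ))) • (C * Cᵀ))⁻¹ *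
      ((C * diagonal (fun i => Real.exp (f i)) * Cᵀ).det ^ (-(1 / (m : ℝ))) •
        (C * diagonal (fun i => Real.exp (f i)) * Cᵀ)) =
      Cᵀ⁻¹ * diagonal (fun i => Real.exp (f i - (∑ j, f j) / m)) * Cᵀ := by
    have hdi : diagonal (fun i => Real.exp (f i - (∑ j, f j) / m)) =
        Real.exp (-((∑ i, f i) / m)) • diagonal (fun i => Real.exp (f i)) := by
      rw [← diagonal_smul]
      congr 1; funext i
      rw [Pi.smul_apply, smul_eq_mul, ← Real.exp_add]; congr 1; ring
    have hinv : ((C * Cᵀ).det ^ (-(1 / (m : ℝ))) • (C * Cᵀ))⁻¹ =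
        ((C * Cᵀ).det ^ (-(1 / (m : ℝ))))⁻¹ • (C * Cᵀ)⁻¹ := by
      apply inv_eq_left_inv
      rw [smul_mul_smul_comm, inv_mul_cancel₀ hAp.ne', one_smul,
        nonsing_inv_mul _ (isUnit_iff_ne_zero.2 hA.ne')]
    rw [hinv, smul_mul_smul_comm, hscal, inv_mul_congr_diagonal hC, hdi]
    simp
  have hchar : (Cᵀ⁻¹ * diagonal (fun i => Real.exp (f i - (∑ j, f j) / m)) * Cᵀ).charpoly =
      (diagonal fun i => Real.exp (f i - (∑ j, f j) / m)).charpoly := by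
    rw [charpoly_mul_comm, ← Matrix.mul_assoc,
      mul_nonsing_inv _ ((isUnit_iff_isUnit_det _).1 hCt), Matrix.one_mul]
  rw [dist₁, delta, hmat, hchar, charpoly_diagonal,
    Polynomial.roots_prod _ _ (Finset.prod_ne_zero_iff.2 fun i _ => Polynomial.X_sub_C_ne_zero _)]
  simp only [Polynomial.roots_X_sub_C, Multiset.bind_singleton, Multiset.map_map,
    Function.comp_def, Real.log_exp]
  rfl

end Parameters

/-! ### The range of the parameter `β` -/

theorem beta_bounds {m d : ℝ} (hm : 0 < m) (hd : 0 < d) :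
    -Real.pi * ((√(Real.pi ^ 2 * m ^ 2 + 4 * m * d ^ 2) + Real.pi * m) / (2 * m * d ^ 2)) < 0 ∧
    0 < Real.pi * ((√(Real.pi ^ 2 * m ^ 2 + 4 * m * d ^ 2) - Real.pi * m) / (2 * m * d ^ 2)) ∧
    Real.pi * ((√(Real.pi ^ 2 * m ^ 2 + 4 * m * d ^ 2) - Real.pi * m) / (2 * m * d ^ 2)) < 1 / m := by
  have hpi := Real.pi_pos
  set r := √(Real.pi ^ 2 * m ^ 2 + 4 * m * d ^ 2) with hr
  have hr2 : r ^ 2 = Real.pi ^ 2 * m ^ 2 + 4 * m * d ^ 2 := Real.sq_sqrt (by positivity)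
  have hr0 : 0 ≤ r := Real.sqrt_nonneg _
  have hmd : 0 < m * d ^ 2 := by positivity
  have h1 : Real.pi * m < r := lt_of_pow_lt_pow_left₀ 2 hr0 (by rw [hr2]; nlinarith)
  refine ⟨?_, ?_, ?_⟩
  · have : 0 < Real.pi * ((r + Real.pi * m) / (2 * m * d ^ 2)) := by positivity
    linarith
  · have : 0 < r - Real.pi * m := sub_pos.2 h1
    positivity
  -- squared, the claim is `0 < 4 d ^ 4`
  · have h2 : Real.pi * r < 2 * d ^ 2 + Real.pi ^ 2 * m := by
      refine lt_of_pow_lt_pow_left₀ 2 (by positivity) ?_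
      rw [mul_pow, hr2]
      nlinarith [pow_pos hd 4]
    rw [mul_div_assoc', div_lt_div_iff₀ (by positivity) hm]
    nlinarith

theorem mem_beta_interval_iff {m d β : ℝ} (hm : 0 < m) (hd : 0 < d) (hβ : β ≠ 0)
    (hβm : β < 1 / m) :
    β ∈ Ioo (-Real.pi * ((√(Real.pi ^ 2 * m ^ 2 + 4 * m * d ^ 2) + Real.pi * m) /
        (2 * m * d ^ 2))) 0 ∪
      Ioo 0 (Real.pi * ((√(Real.pi ^ 2 * m ^ 2 + 4 * m * d ^ 2) - Real.pi * m) /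
        (2 * m * d ^ 2))) ↔
    0 < |β| * d / (2 * √(1 / m - β)) ∧ |β| * d / (2 * √(1 / m - β)) < Real.pi / 2 := by
  have hpi := Real.pi_pos
  obtain ⟨hb1, hb2, -⟩ := beta_bounds hm hd
  set r := √(Real.pi ^ 2 * m ^ 2 + 4 * m * d ^ 2) with hr
  have hr2 : r ^ 2 = Real.pi ^ 2 * m ^ 2 + 4 * m * d ^ 2 := Real.sq_sqrt (by positivity)
  set b1 := -Real.pi * ((r + Real.pi * m) / (2 * m * d ^ 2)) with hb1d
  set b2 := Real.pi * ((r - Real.pi * m) / (2 * m * d ^ 2)) with hb2d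
  have hgap : 0 < 1 / m - β := sub_pos.2 hβm
  have hs : 0 < √(1 / m - β) := Real.sqrt_pos.2 hgap
  have hs2 : √(1 / m - β) ^ 2 = 1 / m - β := Real.sq_sqrt hgap.le
  have hab : 0 < |β| := abs_pos.2 hβ
  -- `b1` and `b2` are the roots of the quadratic polynomial `d² β² + π² β - π² / m`
  have hquad : β ^ 2 * d ^ 2 - Real.pi ^ 2 * (1 / m - β) = d ^ 2 * ((β - b1) * (β - b2)) := by
    have hsum : b1 + b2 = -Real.pi ^ 2 / d ^ 2 := by
      rw [hb1d, hb2d]; field_simp; ring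
    have hprod : b1 * b2 = -Real.pi ^ 2 / (m * d ^ 2) := by
      have : b1 * b2 = -Real.pi ^ 2 * (r ^ 2 - Real.pi ^ 2 * m ^ 2) / (4 * m ^ 2 * d ^ 4) := by
        rw [hb1d, hb2d]; field_simp; ring
      rw [this, hr2]; field_simp; ring
    have : (β - b1) * (β - b2) = β ^ 2 - (b1 + b2) * β + b1 * b2 := by ring
    rw [this, hsum, hprod]
    field_simp
    ring
  have hγ : |β| * d / (2 * √(1 / m - β)) < Real.pi / 2 ↔
      β ^ 2 * d ^ 2 < Real.pi ^ 2 * (1 / m - β) := by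
    have e : Real.pi ^ 2 * (1 / m - β) = (Real.pi * √(1 / m - β)) ^ 2 := by rw [mul_pow, hs2]
    rw [div_lt_div_iff₀ (by positivity) two_pos, e, ← sq_abs β, ← mul_pow,
      sq_lt_sq₀ (by positivity) (by positivity)]
    constructor <;> intro h <;> linarith
  have hlt : |β| * d / (2 * √(1 / m - β)) < Real.pi / 2 ↔ (β - b1) * (β - b2) < 0 := by
    rw [hγ, ← sub_neg, hquad]
    exact ⟨fun h => by by_contra! hc; exact absurd h (not_lt.2 (by positivity)),
      fun h => mul_neg_of_pos_of_neg (by positivity) h⟩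
  have hpos : 0 < |β| * d / (2 * √(1 / m - β)) := by positivity
  rw [and_iff_right hpos, hlt]
  constructor
  · rintro (⟨h1, h2⟩ | ⟨h1, h2⟩)
    · exact mul_neg_of_pos_of_neg (by linarith) (by linarith)
    · exact mul_neg_of_pos_of_neg (by linarith) (by linarith)
  · intro h
    rcases mul_neg_iff.1 h with ⟨h1, h2⟩ | ⟨h1, h2⟩
    · rcases lt_or_gt_of_ne hβ with h0 | h0
      · exact Or.inl ⟨by linarith, h0⟩
      · exact Or.inr ⟨h0, by linarith⟩
    · linarith

section Geodesic

variable {m : ℕ} {C : Matrix (Fin m) (Fin m) ℝ} {f : Fin m → ℝ} {β : ℝ}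

/-! ### The geodesic between two positive definite matrices -/

/-- The traceless part of `f`, divided by its Euclidean norm; it is zero if `f` is constant. -/
noncomputable def tracelessDirection (f : Fin m → ℝ) (i : Fin m) : ℝ :=
  (f i - (∑ j, f j) / m) / √(∑ i, (f i - (∑ j, f j) / m) ^ 2)

theorem sum_sub_mean (hm : (m : ℝ) ≠ 0) (f : Fin m → ℝ) : ∑ i, (f i - (∑ j, f j) / m) = 0 := by
  rw [Finset.sum_sub_distrib, Finset.sum_const, Finset.card_univ, Fintype.card_fin, nsmul_eq_mul,
    mul_div_cancel₀ _ hm, sub_self]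

theorem sum_tracelessDirection (hm : (m : ℝ) ≠ 0) (f : Fin m → ℝ) :
    ∑ i, tracelessDirection f i = 0 := by
  simp only [tracelessDirection, ← Finset.sum_div, sum_sub_mean hm f, zero_div]

theorem sub_mean_eq (f : Fin m → ℝ) (i : Fin m) : f i - (∑ j, f j) / m =
    √(∑ i, (f i - (∑ j, f j) / m) ^ 2) * tracelessDirection f i := by
  rcases eq_or_ne (√(∑ i, (f i - (∑ j, f j) / m) ^ 2)) 0 with h | h
  · have h1 := (Real.sqrt_eq_zero (Finset.sum_nonneg fun i _ => sq_nonneg _)).1 h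
    have h2 := (Finset.sum_eq_zero_iff_of_nonneg fun i _ => sq_nonneg _).1 h1 i (Finset.mem_univ i)
    rw [h, zero_mul]
    exact pow_eq_zero_iff two_ne_zero |>.1 h2
  · rw [tracelessDirection, mul_div_cancel₀ _ h]

theorem sum_tracelessDirection_sq (h : √(∑ i, (f i - (∑ j, f j) / m) ^ 2) ≠ 0) :
    ∑ i, tracelessDirection f i ^ 2 = 1 := by
  have h1 := Real.sq_sqrt (Finset.sum_nonneg fun i (_ : i ∈ Finset.univ) =>
    sq_nonneg (f i - (∑ j, f j) / m))
  simp only [tracelessDirection, div_pow, ← Finset.sum_div]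
  rw [h1, div_self]
  rw [← h1]
  exact pow_ne_zero 2 h

theorem sum_tracelessDirection_mul (hm : (m : ℝ) ≠ 0) (f : Fin m → ℝ) :
    ∑ i, tracelessDirection f i * f i = √(∑ i, (f i - (∑ j, f j) / m) ^ 2) := by
  have h : ∀ i, tracelessDirection f i * f i = tracelessDirection f i * ((∑ j, f j) / m) +
      √(∑ i, (f i - (∑ j, f j) / m) ^ 2) * tracelessDirection f i ^ 2 := fun i => by
    have := sub_mean_eq f i
    linear_combination tracelessDirection f i * this
  rw [Finset.sum_congr rfl fun i _ => h i, Finset.sum_add_distrib, ← Finset.sum_mul,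
    ← Finset.mul_sum, sum_tracelessDirection hm, zero_mul, zero_add]
  rcases eq_or_ne (√(∑ i, (f i - (∑ j, f j) / m) ^ 2)) 0 with h0 | h0
  · rw [h0, zero_mul]
  · rw [sum_tracelessDirection_sq h0, mul_one]

/-- The factor by which the cone structure of the power metric rescales distances in the determinant
one slice to angles. -/
noncomputable def coneFactor (m : ℕ) (β : ℝ) : ℝ := |β| / (2 * √(1 / (m : ℝ) - β))

theorem gamma_eq_coneFactor_mul (A B : Matrix (Fin m) (Fin m) ℝ) :
    gamma β A B = coneFactor m β * dist₁ A B := by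
  rw [gamma, coneFactor]; ring

/-- The planar development of the geodesic ends at the point with polar coordinates `σ`, `γ`. -/
theorem isUniqueGeodesic_conj_segmentCurve (hm : (m : ℝ) ≠ 0) (hC : IsUnit C) (hβ : β ≠ 0)
    (hβm : β < 1 / m)
    (hγ : gamma β (C * Cᵀ) (C * diagonal (fun i => Real.exp (f i)) * Cᵀ) < Real.pi / 2) :
    IsUniqueGeodesic β (C * Cᵀ) (C * diagonal (fun i => Real.exp (f i)) * Cᵀ) fun t =>
      C * segmentCurve β (coneFactor m β) (tracelessDirection f)
        (sigma β (C * Cᵀ) (C * diagonal (fun i => Real.exp (f i)) * Cᵀ) *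
          Real.cos (gamma β (C * Cᵀ) (C * diagonal (fun i => Real.exp (f i)) * Cᵀ)))
        (sigma β (C * Cᵀ) (C * diagonal (fun i => Real.exp (f i)) * Cᵀ) *
          Real.sin (gamma β (C * Cᵀ) (C * diagonal (fun i => Real.exp (f i)) * Cᵀ))) t * Cᵀ := by
  have hgap : 0 < 1 / (m : ℝ) - β := sub_pos.2 hβm
  have hk0 : 0 < coneFactor m β := by
    have := abs_pos.2 hβ
    have := Real.sqrt_pos.2 hgap
    rw [coneFactor]; positivity
  have hk : coneFactor m β ^ 2 * (4 * (1 / m - β)) = β ^ 2 := by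
    rw [coneFactor, div_pow, mul_pow, Real.sq_sqrt hgap.le, sq_abs]
    generalize 1 / (m : ℝ) - β = z at hgap
    field_simp
    norm_num
  have hγe : gamma β (C * Cᵀ) (C * diagonal (fun i => Real.exp (f i)) * Cᵀ) =
      coneFactor m β * ∑ i, tracelessDirection f i * f i := by
    rw [gamma_eq_coneFactor_mul, dist₁_eq hC, sum_tracelessDirection_mul hm]
  have hγ0 : 0 ≤ coneFactor m β * ∑ i, tracelessDirection f i * f i := by
    rw [sum_tracelessDirection_mul hm]
    exact mul_nonneg hk0.le (Real.sqrt_nonneg _)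
  rw [hγe] at hγ ⊢
  have hv1 : ∑ i, tracelessDirection f i ^ 2 = 1 ∨ ∑ i, tracelessDirection f i * f i = 0 := by
    rw [sum_tracelessDirection_mul hm]
    by_cases h : √(∑ i, (f i - (∑ j, f j) / m) ^ 2) = 0
    · exact Or.inr h
    · exact Or.inl (sum_tracelessDirection_sq h)
  have hvle : ∑ i, tracelessDirection f i ^ 2 ≤ 1 := by
    by_cases h : √(∑ i, (f i - (∑ j, f j) / m) ^ 2) = 0
    · simp [tracelessDirection, h]
    · exact (sum_tracelessDirection_sq h).le
  have h := (isUniqueGeodesic_segmentCurve hm hβ hβm hk hk0 (sum_tracelessDirection hm f) hv1 hvle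
    (fun i => by
      rw [sum_tracelessDirection_mul hm, ← sub_mean_eq]; ring)
    (by linarith [Real.pi_pos]) hγ).conj hC
  rw [Matrix.mul_one] at h
  rw [sigma_eq hC]
  exact h

theorem isUniqueGeodesic_of_gamma_pos (hm : (m : ℝ) ≠ 0) (hC : IsUnit C) (hβ : β ≠ 0)
    (hβm : β < 1 / m)
    (hγ0 : 0 < gamma β (C * Cᵀ) (C * diagonal (fun i => Real.exp (f i)) * Cᵀ))
    (hγ : gamma β (C * Cᵀ) (C * diagonal (fun i => Real.exp (f i)) * Cᵀ) < Real.pi / 2) :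
    IsUniqueGeodesic β (C * Cᵀ) (C * diagonal (fun i => Real.exp (f i)) * Cᵀ) fun t =>
      eta β (C * Cᵀ) (C * diagonal (fun i => Real.exp (f i)) * Cᵀ) t •
        (C * Cᵀ * matPow ((C * Cᵀ)⁻¹ * (C * diagonal (fun i => Real.exp (f i)) * Cᵀ))
          (alpha β (C * Cᵀ) (C * diagonal (fun i => Real.exp (f i)) * Cᵀ) t)) := by
  refine (isUniqueGeodesic_conj_segmentCurve hm hC hβ hβm hγ).congr fun t ht => ?_
  have hCt : IsUnit Cᵀ.det := (isUnit_iff_isUnit_det _).1 ((isUnit_transpose C).2 hC)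
  have hd := gamma_eq_coneFactor_mul (β := β) (C * Cᵀ)
    (C * diagonal (fun i => Real.exp (f i)) * Cᵀ)
  have hdist := dist₁_eq (f := f) hC
  simp only [eta]
  rw [matPow_eq (isPosDiagonalization_inv_mul hC), sigma_eq hC]
  set a := alpha β (C * Cᵀ) (C * diagonal (fun i => Real.exp (f i)) * Cᵀ) t with ha
  rw [alpha, sigma_eq hC] at ha
  set g := gamma β (C * Cᵀ) (C * diagonal (fun i => Real.exp (f i)) * Cᵀ) with hg
  rw [hdist] at hd
  set s := Real.exp (β / 2 * ∑ i, f i) with hs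
  have hspos : 0 < s := Real.exp_pos _
  have hcos : 0 < Real.cos g := Real.cos_pos_of_mem_Ioo ⟨by linarith, hγ⟩
  have hp : 0 < 1 + t * (s * Real.cos g - 1) := segment_pos (mul_pos hspos hcos) ht
  have hden : 1 - t + t * s * Real.cos g = 1 + t * (s * Real.cos g - 1) := by ring
  -- the square of the radius of the point at parameter `t` of the segment
  have hrad : (1 - t) ^ 2 + 2 * t * (1 - t) * s * Real.cos g + t ^ 2 * s ^ 2 =
      (1 + t * (s * Real.cos g - 1)) ^ 2 + (t * (s * Real.sin g)) ^ 2 := by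
    linear_combination -(t ^ 2 * s ^ 2) * Real.sin_sq_add_cos_sq g
  rw [hden, mul_assoc] at ha
  have hr : 0 < (1 + t * (s * Real.cos g - 1)) ^ 2 + (t * (s * Real.sin g)) ^ 2 := by positivity
  have hk0 : coneFactor m β ≠ 0 := fun h => by rw [h, zero_mul] at hd; linarith
  have hd0 : √(∑ i, (f i - (∑ j, f j) / m) ^ 2) ≠ 0 := fun h => by
    rw [h, mul_zero] at hd; linarith
  have hmul : C * Cᵀ * (Cᵀ⁻¹ * diagonal (fun i => Real.exp (f i) ^ a) * Cᵀ) =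
      C * diagonal (fun i => Real.exp (f i) ^ a) * Cᵀ := by
    calc _ = C * (Cᵀ * Cᵀ⁻¹) * diagonal (fun i => Real.exp (f i) ^ a) * Cᵀ := by
          simp only [Matrix.mul_assoc]
      _ = _ := by rw [mul_nonsing_inv _ hCt, Matrix.mul_one]
  rw [hmul, ← Matrix.smul_mul, ← Matrix.mul_smul, ← diagonal_smul, segmentCurve]
  congr 3
  funext i
  rw [Pi.smul_apply, smul_eq_mul, hrad, hs, ← Real.exp_mul, ← hs, ← Real.exp_log hr, ← Real.exp_sub,
    ← Real.exp_mul, ← Real.exp_mul, ← Real.exp_add, logCoord]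
  congr 1
  have h1 := sub_mean_eq f i
  have h2 : Real.arctan (t * (s * Real.sin g) / (1 + t * (s * Real.cos g - 1))) = g * a := by
    rw [ha]; field_simp
  have h3 : g * a / coneFactor m β * tracelessDirection f i = a * (f i - (∑ j, f j) / m) := by
    rw [h1, hd]
    generalize √(∑ i, (f i - (∑ j, f j) / (m : ℝ)) ^ 2) = δ
    field_simp
  rw [h2, h3]
  field_simp
  ring

/-- For proportional matrices `γ = 0`, and the planar development of the geodesic is a radial
segment. -/
theorem isUniqueGeodesic_smul (hm : (m : ℝ) ≠ 0) {A : Matrix (Fin m) (Fin m) ℝ} (hA : A.PosDef)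
    {c : ℝ} (hc : 0 < c) (hβ : β ≠ 0) (hβm : β < 1 / m) :
    IsUniqueGeodesic β A (c • A) fun t =>
      matPow ((1 - t) • matPow A (m * β / 2) + t • matPow (c • A) (m * β / 2))
        (2 / (m * β)) := by
  obtain ⟨C, -, hC, hAC, -⟩ := exists_simultaneous_diagonalization hA hA
  have hcA : c • A = C * Matrix.diagonal (fun _ => Real.exp (Real.log c)) * Cᵀ := by
    rw [hAC, Real.exp_log hc, ← smul_one_eq_diagonal]
    simp
  obtain ⟨M, a, hM, -⟩ := exists_orthogonal_diagonalization hA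
  have hMc : IsPosDiagonalization (c • A) M fun i => c * a i := by
    refine ⟨hM.1, fun i => mul_pos hc (hM.2.1 i), ?_⟩
    conv_lhs => rw [hM.2.2]
    rw [← Matrix.smul_mul, ← Matrix.mul_smul, ← diagonal_smul]
    rfl
  have hd0 : dist₁ A (c • A) = 0 := by
    rw [hcA, hAC, dist₁_eq hC]
    simp [hm]
  have hg0 : gamma β A (c • A) = 0 := by rw [gamma, hd0]; simp
  have hσ : sigma β A (c • A) = c ^ (m * β / 2) := by
    rw [hcA, hAC, sigma_eq hC, Real.rpow_def_of_pos hc]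
    congr 1
    simp
    ring
  have hγ : gamma β A (c • A) < Real.pi / 2 := by rw [hg0]; linarith [Real.pi_pos]
  have h := isUniqueGeodesic_conj_segmentCurve (f := fun _ => Real.log c) hm hC hβ hβm (by
    rwa [← hcA, ← hAC])
  rw [← hcA, ← hAC, hg0, hσ, Real.cos_zero, Real.sin_zero, mul_one, mul_zero] at h
  refine h.congr fun t ht => ?_
  set q : ℝ := m * β / 2 with hq
  have hcq : 0 < c ^ q := Real.rpow_pos_of_pos hc q
  have hp : 0 < 1 + t * (c ^ q - 1) := segment_pos hcq ht
  have hsum : IsPosDiagonalization ((1 - t) • matPow A q + t • matPow (c • A) q) M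
      fun i => (1 + t * (c ^ q - 1)) * a i ^ q := by
    refine ⟨hM.1, fun i => mul_pos hp (Real.rpow_pos_of_pos (hM.2.1 i) _), ?_⟩
    have hdi : (diagonal fun i => (1 + t * (c ^ q - 1)) * a i ^ q) =
        (1 - t) • diagonal (fun i => a i ^ q) + t • diagonal (fun i => (c * a i) ^ q) := by
      rw [← diagonal_smul, ← diagonal_smul, diagonal_add]
      congr 1
      funext i
      simp only [Pi.smul_apply, smul_eq_mul]
      rw [Real.mul_rpow hc.le (hM.2.1 i).le]
      ring
    rw [hdi, matPow_eq hM, matPow_eq hMc, Matrix.mul_add, Matrix.add_mul]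
    simp
  have hqq : q * (2 / (m * β)) = 1 := by rw [hq]; field_simp
  simp only
  rw [matPow_eq hsum]
  have hL : ∀ i, ((1 + t * (c ^ q - 1)) * a i ^ q) ^ (2 / (m * β)) =
      (1 + t * (c ^ q - 1)) ^ (2 / (m * β)) * a i := fun i => by
    rw [Real.mul_rpow hp.le (Real.rpow_nonneg (hM.2.1 i).le _), ← Real.rpow_mul (hM.2.1 i).le, hqq,
      Real.rpow_one]
  have hR : segmentCurve β (coneFactor m β) (tracelessDirection fun _ => Real.log c) (c ^ q) 0 t =
      (1 + t * (c ^ q - 1)) ^ (2 / (m * β)) • (1 : Matrix (Fin m) (Fin m) ℝ) := by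
    rw [segmentCurve, smul_one_eq_diagonal]
    congr 1
    funext i
    simp only [logCoord, mul_zero, zero_div, Real.arctan_zero, zero_mul, add_zero]
    rw [Real.rpow_def_of_pos hp, zero_pow two_ne_zero, add_zero, Real.log_pow]
    congr 1
    push_cast
    ring
  have hD : (diagonal fun i => (1 + t * (c ^ q - 1)) ^ (2 / (m * β)) * a i) =
      (1 + t * (c ^ q - 1)) ^ (2 / (m * β)) • diagonal a := by
    rw [← diagonal_smul]; rfl
  simp only [hL]
  rw [hR, hD, Matrix.mul_smul, Matrix.smul_mul, Matrix.mul_smul, Matrix.smul_mul, Matrix.mul_one,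
    ← hAC, ← hM.2.2]

end Geodesic

theorem dist₁_pos_of_linearIndependent {m : ℕ} {A B : Matrix (Fin m) (Fin m) ℝ}
    (hA : A.PosDef) (hB : B.PosDef) (h : LinearIndependent ℝ ![A, B]) : 0 < dist₁ A B := by
  obtain ⟨C, f, hC, rfl, rfl⟩ := exists_simultaneous_diagonalization hA hB
  rw [dist₁_eq hC]
  refine lt_of_le_of_ne (Real.sqrt_nonneg _) fun h0 => ?_
  have hf : ∀ i, f i = (∑ j, f j) / m := fun i => by
    have := sub_mean_eq f i
    rw [← h0, zero_mul] at this
    exact sub_eq_zero.1 this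
  have hdi : diagonal (fun i => Real.exp (f i)) =
      Real.exp ((∑ j, f j) / m) • (1 : Matrix (Fin m) (Fin m) ℝ) := by
    rw [smul_one_eq_diagonal]
    congr 1
    funext i
    rw [← hf i]
  have := (LinearIndependent.pair_iff.1 h (Real.exp ((∑ j, f j) / m)) (-1) (by
    rw [hdi]; simp)).2
  norm_num at this

theorem exists_pos_smul_of_not_linearIndependent {m : ℕ} [NeZero m]
    {A B : Matrix (Fin m) (Fin m) ℝ} (hA : A.PosDef) (hB : B.PosDef)
    (h : ¬ LinearIndependent ℝ ![A, B]) : ∃ c : ℝ, 0 < c ∧ B = c • A := by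
  rw [LinearIndependent.pair_iff] at h
  push Not at h
  obtain ⟨s, t, h0, hne⟩ := h
  have ha : 0 < A 0 0 := hA.diag_pos
  have hb : 0 < B 0 0 := hB.diag_pos
  have h00 : s * A 0 0 + t * B 0 0 = 0 := by
    simpa using congrFun (congrFun h0 0) 0
  have ht : t ≠ 0 := fun ht => by
    rw [ht, zero_mul, add_zero] at h00
    exact hne ((mul_eq_zero.1 h00).resolve_right ha.ne') ht
  have hBA : B = (-s / t) • A := by
    have : t • B = -s • A := by
      rw [neg_smul, eq_neg_iff_add_eq_zero, add_comm]; exact h0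
    rw [div_eq_inv_mul, mul_smul, ← this, smul_smul, inv_mul_cancel₀ ht, one_smul]
  refine ⟨-s / t, ?_, hBA⟩
  rw [hBA] at hb
  exact pos_of_mul_pos_left (by simpa using hb) ha.le

end PowerCone

theorem mainTheorem1 (n : ℕ) (hn : 1 ≤ n) (A B : Matrix (Fin n) (Fin n) ℝ)
    (hA : A.PosDef) (hB : B.PosDef) :
    (LinearIndependent ℝ ![A, B] →
      (PowerCone.beta₁ A B < 0 ∧ 0 < PowerCone.beta₂ A B ∧ PowerCone.beta₂ A B < 1 / (n : ℝ)) ∧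
      (∀ β : ℝ, β ≠ 0 → β < 1 / (n : ℝ) →
        (β ∈ Set.Ioo (PowerCone.beta₁ A B) 0 ∪ Set.Ioo 0 (PowerCone.beta₂ A B) ↔
          0 < PowerCone.gamma β A B ∧ PowerCone.gamma β A B < Real.pi / 2)) ∧
      (∀ β ∈ Set.Ioo (PowerCone.beta₁ A B) 0 ∪ Set.Ioo 0 (PowerCone.beta₂ A B),
        PowerCone.IsUniqueGeodesic β A B (fun t =>
          PowerCone.eta β A B t • (A * PowerCone.matPow (A⁻¹ * B) (PowerCone.alpha β A B t))))) ∧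
    (¬ LinearIndependent ℝ ![A, B] →
      ∀ β : ℝ, β ≠ 0 → β < 1 / (n : ℝ) →
        PowerCone.IsUniqueGeodesic β A B (fun t =>
          PowerCone.matPow
            ((1 - t) • PowerCone.matPow A (n * β / 2) + t • PowerCone.matPow B (n * β / 2))
            (2 / (n * β)))) := by
  have hn0 : 0 < (n : ℝ) := by exact_mod_cast hn
  refine ⟨fun hli => ?_, fun hld β hβ hβn => ?_⟩
  · have hd := PowerCone.dist₁_pos_of_linearIndependent hA hB hli
    have hbounds : PowerCone.beta₁ A B < 0 ∧ 0 < PowerCone.beta₂ A B ∧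
        PowerCone.beta₂ A B < 1 / (n : ℝ) := PowerCone.beta_bounds hn0 hd
    have hiff : ∀ β : ℝ, β ≠ 0 → β < 1 / (n : ℝ) →
        (β ∈ Set.Ioo (PowerCone.beta₁ A B) 0 ∪ Set.Ioo 0 (PowerCone.beta₂ A B) ↔
          0 < PowerCone.gamma β A B ∧ PowerCone.gamma β A B < Real.pi / 2) :=
      fun β hβ hβn => PowerCone.mem_beta_interval_iff hn0 hd hβ hβn
    refine ⟨hbounds, hiff, fun β hβ => ?_⟩
    have hβ0 : β ≠ 0 := by
      rcases hβ with h | h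
      · exact h.2.ne
      · exact h.1.ne'
    have hβn : β < 1 / (n : ℝ) := by
      rcases hβ with h | h
      · exact h.2.trans (by positivity)
      · exact h.2.trans hbounds.2.2
    obtain ⟨hγ0, hγ⟩ := (hiff β hβ0 hβn).1 hβ
    obtain ⟨C, f, hC, rfl, rfl⟩ := PowerCone.exists_simultaneous_diagonalization hA hB
    exact PowerCone.isUniqueGeodesic_of_gamma_pos hn0.ne' hC hβ0 hβn hγ0 hγ
  · have : NeZero n := ⟨by omega⟩
    obtain ⟨c, hc, rfl⟩ := PowerCone.exists_pos_smul_of_not_linearIndependent hA hB hld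
    exact PowerCone.isUniqueGeodesic_smul hn0.ne' hA hc hβ hβn
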